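/- Fix a finite relational schema whose attributes range over one of two disjoint infinite domains (the rationals, or uninterpreted constants identified by their names); an instance is a finite set $I$ of facts $R(t)$. Let $F$ be a set of functional dependencies over the schema that contains at most one functional dependency per relation name (and no other constraints). A *conflict* in $I$ is a pair of facts $\{R(t),R(u)\}\subseteq I$ such that for some $R:X\to Y$ in $F$ the tuples $t,u$ agree on $X$ and disagree on $Y$; two facts are *neighbors* if some conflict contains both. A *repair* of $I$ is a maximal subset of $I$ that is consistent with $F$. A *priority* of $I$ w.r.t. $F$ is an acyclic binary relation $\succ$ on $I$ that relates only neighbors; it is *total* if no other priority of $I$ w.r.t. $F$ extends it. A repair $I'$ of $I$ is - *Pareto optimal* w.r.t. $\succ$ if there are no nonempty $X\subseteq I'$ and nonempty $Y\subseteq I\setminus I'$ such that $y\succ x$ for all $x\in X$ and all $y\in Y$, and $(I'\setminus X)\cup Y$ is consistent with $F$; - *globally optimal* w.r.t. $\succ$ if there are no nonempty $X\subseteq I'$ and $Y\subseteq I\setminus I'$ such that for every $x\in X$ there is $y\in Y$ with $y\succ x$, and $(I'\setminus X)\cup Y$ is consistent with $F$; - *common optimal* w.r.t. $\succ$ if it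 is globally optimal w.r.t. some total priority $\succ'\supseteq\succ$. Write $\mathcal{P}Rep(I,F,\succ)$, $\mathcal{G}Rep(I,F,\succ)$ and $\mathcal{C}Rep(I,F,\succ)$ for the sets of Pareto, globally and common optimal repairs. For a family $\mathcal{X}Rep$ of preferred repairs, a closed query $Q$ and a truth value $b\in\{\mathbf{true},\mathbf{false}\}$, $b$ is the *$\mathcal{X}$-preferred consistent answer* to $Q$ in $I$ w.r.t. $F$ and $\succ$ if $Q$ has truth value $b$ in every $I'\in\mathcal{X}Rep(I,F,\succ)$. **Theorem.** For every such fixed $F$, every fixed closed quantifier-free query $Q$ (a Boolean combination of facts and of built-in comparisons $=,\neq$ between uninterpreted constants and $=,\neq,<,\leq,>,\geq$ between rationals), every $b\in\{\mathbf{true},\mathbf{false}\}$ and every $\mathcal{X}\in\{\mathcal{P},\mathcal{G},\mathcal{C}\}$, the following problem is in PTIME, i.e. it is decided by a deterministic Turing machine in time polynomial in the length of the input: given an instance $I$ and a binary relation $\succ$ on facts (written as lists of facts and of pairs of facts, with numbers in binary), decide whether $\succ$ is a priority of $I$ w.r.t. $F$ and $b$ is the $\mathcal{X}$-preferred consistent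 answer to $Q$ in $I$ w.r.t. $F$ and $\succ$. -/

import Mathlib

namespace CQA

/-! ### Relational databases -/

/-- The two disjoint domains of constants. -/
inductive DomainKind
  | rational
  | name

/-- Constants of each domain: the rationals, and uninterpreted constants. An uninterpreted constant
is its name (a finite binary word): two of them are equal iff they have the same name. -/
abbrev Const : DomainKind → Type
  | .rational => ℚ
  | .name => List Bool

instance constDecidableEq : (k : DomainKind) → DecidableEq (Const k)
  | .rational => inferInstanceAs (DecidableEq ℚ)
  | .name => inferInstanceAs (DecidableEq (List Bool))

/-- A (finite) database schema: relation names with their arities, every attribute being typed by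
one of the two domains. Attributes of a relation are identified with their positions. -/
structure Schema where
  numRel : ℕ
  arity : Fin numRel → ℕ
  dom : (R : Fin numRel) → Fin (arity R) → DomainKind

/-- Well-typed tuples of constants of the relation `R`. -/
abbrev Tuple (S : Schema) (R : Fin S.numRel) : Type :=
  (i : Fin (S.arity R)) → Const (S.dom R i)

/-- Facts `R(t)`. -/
abbrev Fact (S : Schema) : Type :=
  Σ R : Fin S.numRel, Tuple S R

/-- Database instances: finite sets of facts. -/
abbrev DBInstance (S : Schema) : Type :=
  Finset (Fact S)

/-! ### Functional dependencies -/

/-- A functional dependency `rel : lhs → rhs`. -/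
structure FD (S : Schema) where
  rel : Fin S.numRel
  lhs : Finset (Fin (S.arity rel))
  rhs : Finset (Fin (S.arity rel))

/-- The facts `p = R(t)` and `q = R(u)` jointly violate the functional dependency `R : X → Y`:
`t` and `u` have the same values in `X` and different values in `Y`. -/
def FD.Violates {S : Schema} (f : FD S) (p q : Fact S) : Prop :=
  ∃ t u : Tuple S f.rel, p = ⟨f.rel, t⟩ ∧ q = ⟨f.rel, u⟩ ∧
    (∀ i ∈ f.lhs, t i = u i) ∧ ¬ ∀ i ∈ f.rhs, t i = u i

/-- `I ⊨ F`. -/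
def Consistent {S : Schema} (F : Set (FD S)) (I : DBInstance S) : Prop :=
  ∀ f ∈ F, ∀ p ∈ I, ∀ q ∈ I, ¬ f.Violates p q

/-- `C` is a conflict in `I` w.r.t. `F`. -/
def IsConflict {S : Schema} (F : Set (FD S)) (I C : DBInstance S) : Prop :=
  C ⊆ I ∧ ∃ f ∈ F, ∃ p q : Fact S, C = {p, q} ∧ f.Violates p q

/-- `p` and `q` are neighbors: some conflict in `I` contains both. -/
def Neighbors {S : Schema} (F : Set (FD S)) (I : DBInstance S) (p q : Fact S) : Prop :=
  ∃ C : DBInstance S, IsConflict F I C ∧ p ∈ C ∧ q ∈ C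

/-- `J` is a repair of `I` w.r.t. `F`: a maximal subset of `I` consistent with `F`. -/
def IsRepair {S : Schema} (F : Set (FD S)) (I J : DBInstance S) : Prop :=
  J ⊆ I ∧ Consistent F J ∧ ∀ K : DBInstance S, J ⊆ K → K ⊆ I → Consistent F K → K = J

/-! ### Priorities and families of preferred repairs

A relation `r` stands for `≻`: `r p q` means `p ≻ q`. -/

/-- `r` is a priority of `I` w.r.t. `F`: an acyclic binary relation on `I` that relates neighbors
only. -/
def IsPriority {S : Schema} (F : Set (FD S)) (I : DBInstance S)
    (r : Fact S → Fact S → Prop) : Prop :=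
  (∀ p q, r p q → p ∈ I ∧ q ∈ I) ∧
  (∀ p, ¬ Relation.TransGen r p p) ∧
  (∀ p q, r p q → Neighbors F I p q)

/-- A total priority: one that no other priority extends. -/
def IsTotalPriority {S : Schema} (F : Set (FD S)) (I : DBInstance S)
    (r : Fact S → Fact S → Prop) : Prop :=
  IsPriority F I r ∧
    ∀ r' : Fact S → Fact S → Prop, IsPriority F I r' → (∀ p q, r p q → r' p q) → r' = r

/-- `J` is globally optimal: no nonempty `X ⊆ J` can be replaced with some `Y ⊆ I \ J` such that
every `x ∈ X` is dominated by some `y ∈ Y` and the result is consistent. -/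
def GloballyOptimal {S : Schema} (F : Set (FD S)) (I : DBInstance S)
    (r : Fact S → Fact S → Prop) (J : DBInstance S) : Prop :=
  J ⊆ I ∧ ¬ ∃ X Y : DBInstance S, X.Nonempty ∧ X ⊆ J ∧ Y ⊆ I \ J ∧
    (∀ x ∈ X, ∃ y ∈ Y, r y x) ∧ Consistent F ((J \ X) ∪ Y)

/-- `J` is Pareto optimal: no nonempty `X ⊆ J` can be replaced with some nonempty `Y ⊆ I \ J` such
that every `x ∈ X` is dominated by every `y ∈ Y` and the result is consistent. -/
def ParetoOptimal {S : Schema} (F : Set (FD S)) (I : DBInstance S)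
    (r : Fact S → Fact S → Prop) (J : DBInstance S) : Prop :=
  J ⊆ I ∧ ¬ ∃ X Y : DBInstance S, X.Nonempty ∧ X ⊆ J ∧ Y.Nonempty ∧ Y ⊆ I \ J ∧
    (∀ x ∈ X, ∀ y ∈ Y, r y x) ∧ Consistent F ((J \ X) ∪ Y)

/-- `J` is common optimal: it is globally optimal w.r.t. some total priority extending `r`. -/
def CommonOptimal {S : Schema} (F : Set (FD S)) (I : DBInstance S)
    (r : Fact S → Fact S → Prop) (J : DBInstance S) : Prop :=
  J ⊆ I ∧ ∃ r' : Fact S → Fact S → Prop, IsTotalPriority F I r' ∧ (∀ p q, r p q → r' p q) ∧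
    GloballyOptimal F I r' J

/-- Families of preferred repairs. -/
abbrev RepairFamily (S : Schema) : Type :=
  Set (FD S) → DBInstance S → (Fact S → Fact S → Prop) → Set (DBInstance S)

/-- The globally optimal repairs. -/
def globalRep (S : Schema) : RepairFamily S :=
  fun F I r => {J | IsRepair F I J ∧ GloballyOptimal F I r J}

/-- The Pareto optimal repairs. -/
def paretoRep (S : Schema) : RepairFamily S :=
  fun F I r => {J | IsRepair F I J ∧ ParetoOptimal F I r J}

/-- The common optimal repairs. -/
def commonRep (S : Schema) : RepairFamily S :=
  fun F I r => {J | IsRepair F I J ∧ CommonOptimal F I r J}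

/-! ### Quantifier-free queries -/

/-- The built-in relations over the rationals. -/
inductive CompOp
  | eq
  | ne
  | lt
  | le
  | gt
  | ge

/-- Interpretation of the built-in relations over the rationals. -/
def CompOp.Holds : CompOp → ℚ → ℚ → Prop
  | .eq, a, b => a = b
  | .ne, a, b => a ≠ b
  | .lt, a, b => a < b
  | .le, a, b => a ≤ b
  | .gt, a, b => a > b
  | .ge, a, b => a ≥ b

/-- Quantifier-free closed queries. Being closed and quantifier-free, such a formula has no
variables: it is a Boolean combination of facts and of built-in atoms between constants. -/
inductive Query (S : Schema)
  | fact (p : Fact S)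
  | nameEq (a b : Const .name)
  | nameNe (a b : Const .name)
  | comp (op : CompOp) (a b : Const .rational)
  | neg (φ : Query S)
  | conj (φ ψ : Query S)
  | disj (φ ψ : Query S)

/-- `J ⊨ Q`. -/
def Query.Holds {S : Schema} (J : DBInstance S) : Query S → Prop
  | .fact p => p ∈ J
  | .nameEq a b => a = b
  | .nameNe a b => a ≠ b
  | .comp op a b => op.Holds a b
  | .neg φ => ¬ φ.Holds J
  | .conj φ ψ => φ.Holds J ∧ ψ.Holds J
  | .disj φ ψ => φ.Holds J ∨ ψ.Holds J

/-- The truth value `b` is the preferred consistent answer to `Q` w.r.t. the family `X`: `Q` has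
the truth value `b` in every preferred repair. -/
def PreferredAnswer {S : Schema} (X : RepairFamily S) (F : Set (FD S)) (I : DBInstance S)
    (r : Fact S → Fact S → Prop) (Q : Query S) (b : Bool) : Prop :=
  ∀ J ∈ X F I r, (Q.Holds J ↔ b = true)

/-! ### The decision problem -/

/-- An input to the decision problem: an instance, given by a list of its facts, and a binary
relation on facts, given by a list of its pairs. -/
structure Input (S : Schema) where
  facts : List (Fact S)
  pairs : List (Fact S × Fact S)

/-- The instance given by an input. -/
def Input.inst {S : Schema} (x : Input S) : DBInstance S :=
  x.facts.toFinset

/-- The relation given by an input. -/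
def Input.prec {S : Schema} (x : Input S) : Fact S → Fact S → Prop :=
  fun p q => (p, q) ∈ x.pairs

/-- The set of the pairs `(I, ≻)` such that `≻` is a priority of `I` w.r.t. `F` and `b` is the
`X`-preferred consistent answer to `Q` in `I` w.r.t. `F` and `≻`. -/
def answerProblem {S : Schema} (X : RepairFamily S) (F : Set (FD S)) (Q : Query S) (b : Bool) :
    Set (Input S) :=
  {x | IsPriority F x.inst x.prec ∧ PreferredAnswer X F x.inst x.prec Q b}

open Computability (Γ' encodeNat encodeBool)

/-- A constant as a string: a name is written as it is, a rational as a sign bit, the binary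
numerator, a separator and the binary denominator (in lowest terms). -/
def encodeConst : (k : DomainKind) → Const k → List Γ'
  | .rational, (q : ℚ) =>
      Γ'.bit (decide (q.num < 0)) :: (encodeNat q.num.natAbs).map Γ'.bit
        ++ Γ'.blank :: (encodeNat q.den).map Γ'.bit
  | .name, (w : List Bool) => w.map Γ'.bit

/-- A fact as a string: the index of the relation and the constants, separated by commas, between
brackets. -/
def encodeFact {S : Schema} (p : Fact S) : List Γ' :=
  Γ'.bra :: (encodeNat p.1.val).map Γ'.bit
    ++ ((List.ofFn fun i => encodeConst (S.dom p.1 i) (p.2 i)).map (Γ'.comma :: ·)).flatten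
    ++ [Γ'.ket]

/-- An input as a string: the facts, a comma, and the pairs of the relation. -/
def encodeInput {S : Schema} (x : Input S) : List Γ' :=
  x.facts.flatMap encodeFact
    ++ Γ'.comma :: x.pairs.flatMap fun pq => encodeFact pq.1 ++ encodeFact pq.2

/-! Different inputs have different encodings. -/

theorem bit_map_inj : Function.Injective (List.map Γ'.bit) :=
  List.map_injective_iff.2 fun a b h => by injection h

theorem encodeNat_inj : Function.Injective encodeNat := fun a b h => by
  rw [← Computability.decode_encodeNat a, h, Computability.decode_encodeNat]

theorem split_inj {α : Type} {c : α} : ∀ {A B X Y : List α}, c ∉ A → c ∉ B →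
    A ++ c :: X = B ++ c :: Y → A = B ∧ X = Y
  | [], [], _, _, _, _, h => by simpa using h
  | [], b :: B, _, _, _, hB, h => by simp at h hB; exact absurd h.1 hB.1
  | a :: A, [], _, _, hA, _, h => by simp at h hA; exact absurd h.1.symm hA.1
  | a :: A, b :: B, X, Y, hA, hB, h => by
    simp at h hA hB
    obtain ⟨h1, h2⟩ := split_inj hA.2 hB.2 h.2
    exact ⟨by rw [h.1, h1], h2⟩

theorem encodeConst_inj : ∀ k, Function.Injective (encodeConst k)
  | .name => bit_map_inj
  | .rational => fun (p : ℚ) (q : ℚ) h => by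
    simp only [encodeConst] at h
    have := split_inj (by simp) (by simp) h
    obtain ⟨h1, h2⟩ := this
    injection h1 with h0 h1
    injection h0 with h0
    have hn := encodeNat_inj (bit_map_inj h1)
    have hd := encodeNat_inj (bit_map_inj h2)
    apply Rat.ext _ hd
    have : (p.num < 0 ↔ q.num < 0) := by simpa using h0
    omega

theorem encodeConst_clean (k : DomainKind) (v : Const k) :
    Γ'.comma ∉ encodeConst k v ∧ Γ'.ket ∉ encodeConst k v := by
  cases k <;> simp [encodeConst]

theorem segs_inj : ∀ {A B : List Γ'} {L M : List (List Γ')}, Γ'.comma ∉ A → Γ'.comma ∉ B →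
    (∀ l ∈ L, Γ'.comma ∉ l) → (∀ l ∈ M, Γ'.comma ∉ l) →
    A ++ (L.map (Γ'.comma :: ·)).flatten = B ++ (M.map (Γ'.comma :: ·)).flatten → A = B ∧ L = M
  | A, B, [], [], _, _, _, _, h => by simpa using h
  | A, B, [], m :: M, hA, _, _, _, h => by simp at h; subst h; simp at hA
  | A, B, l :: L, [], _, hB, _, _, h => by simp at h; subst h; simp at hB
  | A, B, l :: L, m :: M, hA, hB, hL, hM, h => by
    simp only [List.map_cons, List.flatten_cons, List.cons_append] at h
    obtain ⟨h1, h2⟩ := split_inj hA hB h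
    obtain ⟨h3, h4⟩ := segs_inj (hL l (by simp)) (hM m (by simp))
      (fun x hx => hL x (by simp [hx])) (fun x hx => hM x (by simp [hx])) h2
    exact ⟨h1, by rw [h3, h4]⟩

theorem encodeFact_prefix {S : Schema} {p q : Fact S} {X Y : List Γ'}
    (h : encodeFact p ++ X = encodeFact q ++ Y) : p = q ∧ X = Y := by
  obtain ⟨R, t⟩ := p
  obtain ⟨R', u⟩ := q
  simp only [encodeFact, List.append_assoc, List.cons_append, List.nil_append] at h
  injection h with _ h
  rw [← List.append_assoc, ← List.append_assoc] at h
  have key : ∀ (R : Fin S.numRel) (t : Tuple S R), Γ'.ket ∉ (encodeNat R.val).map Γ'.bit ++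
      ((List.ofFn fun i => encodeConst (S.dom R i) (t i)).map (Γ'.comma :: ·)).flatten := by
    intro R t
    simp only [List.mem_append, List.mem_map, List.mem_flatten, List.mem_ofFn]
    rintro (⟨b, -, hb⟩ | ⟨l, ⟨l', ⟨i, rfl⟩, rfl⟩, hl⟩)
    · cases hb
    · simp [(encodeConst_clean _ _).2] at hl
  obtain ⟨h1, h2⟩ := split_inj (key R t) (key R' u) h
  have clean : ∀ (R : Fin S.numRel) (t : Tuple S R),
      ∀ l ∈ (List.ofFn fun i => encodeConst (S.dom R i) (t i)), Γ'.comma ∉ l := by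
    intro R t l hl
    obtain ⟨i, rfl⟩ := List.mem_ofFn.1 hl
    exact (encodeConst_clean _ _).1
  obtain ⟨h3, h4⟩ := segs_inj (by simp) (by simp) (clean R t) (clean R' u) h1
  have hR := Fin.ext (encodeNat_inj (bit_map_inj h3))
  subst hR
  have := List.ofFn_injective h4
  refine ⟨?_, h2⟩
  congr 1
  funext i
  exact encodeConst_inj _ (congrFun this i)

theorem encodeFacts_prefix {S : Schema} : ∀ {L M : List (Fact S)} {X Y : List Γ'},
    L.flatMap encodeFact ++ Γ'.comma :: X = M.flatMap encodeFact ++ Γ'.comma :: Y → L = M ∧ X = Y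
  | [], [], _, _, h => by simpa using h
  | [], q :: M, _, _, h => by simp [encodeFact] at h
  | p :: L, [], _, _, h => by simp [encodeFact] at h
  | p :: L, q :: M, X, Y, h => by
    simp only [List.flatMap_cons, List.append_assoc] at h
    obtain ⟨h1, h2⟩ := encodeFact_prefix h
    obtain ⟨h3, h4⟩ := encodeFacts_prefix h2
    exact ⟨by rw [h1, h3], h4⟩

theorem encodePairs_inj {S : Schema} : ∀ {L M : List (Fact S × Fact S)},
    (L.flatMap fun pq => encodeFact pq.1 ++ encodeFact pq.2) =
      (M.flatMap fun pq => encodeFact pq.1 ++ encodeFact pq.2) → L = M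
  | [], [], _ => rfl
  | [], q :: M, h => by simp [encodeFact] at h
  | p :: L, [], h => by simp [encodeFact] at h
  | p :: L, q :: M, h => by
    simp only [List.flatMap_cons, List.append_assoc] at h
    obtain ⟨h1, h⟩ := encodeFact_prefix h
    obtain ⟨h2, h⟩ := encodeFact_prefix h
    rw [encodePairs_inj h, Prod.ext h1 h2]

theorem encodeInput_injective {S : Schema} : Function.Injective (encodeInput (S := S)) := by
  rintro ⟨L, P⟩ ⟨M, Q⟩ h
  obtain ⟨h1, h2⟩ := encodeFacts_prefix h
  have h3 := encodePairs_inj h2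
  simp_all

open Classical in
/-- Membership in `L` is decidable in polynomial time by a deterministic Turing machine, inputs
being presented to the machine as strings by `enc`. -/
def InPTIME {α Γ : Type} (enc : α → List Γ) (L : Set α) : Prop :=
  Nonempty (Turing.TM2ComputableInPolyTime enc encodeBool fun a => decide (a ∈ L))

end CQA

/-!
With one functional dependency `X → Y` per relation name, agreement on `X` splits the facts into
groups and agreement on `X ∪ Y` splits every group into parts. Two facts conflict exactly if they
lie in the same group and in different parts, so a repair is a choice of one part in every group.
Each of the three notions of optimality can be checked for each part on its own, by a first-order
condition on the facts of the part; hence the preferred repairs are the free combinations of good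
parts, one for each group, and the query can be falsified exactly if one of the finitely many truth
assignments to its facts that falsify it is realised by such a choice.

Every first-order property of the input is decided in polynomial time by nested loops over the
suffixes of the input word. Acyclicity of the priority is not first-order: it is decided by
repeatedly marking the pairs that are preceded by marked pairs only; there is no cycle exactly if
all pairs end up marked.
-/

namespace CQA

open Turing Computability

/-! ### Structured programs for stack machines -/

section Machine

variable {K : Type} [DecidableEq K] {Γ : K → Type} {σ Λ Λ' : Type}

/-- Rename the labels of a statement by `f` and continue with `h` instead of halting. -/
def graft (f : Λ → Λ') (h : TM2.Stmt Γ Λ' σ) : TM2.Stmt Γ Λ σ → TM2.Stmt Γ Λ' σ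
  | .push k g q => .push k g (graft f h q)
  | .peek k g q => .peek k g (graft f h q)
  | .pop k g q => .pop k g (graft f h q)
  | .load g q => .load g (graft f h q)
  | .branch g q₁ q₂ => .branch g (graft f h q₁) (graft f h q₂)
  | .goto l => .goto fun v => f (l v)
  | .halt => h

theorem stepAux_graft (f : Λ → Λ') (h : TM2.Stmt Γ Λ' σ) (q : TM2.Stmt Γ Λ σ) (v : σ)
    (S : ∀ k, List (Γ k)) :
    TM2.stepAux (graft f h q) v S =
      match TM2.stepAux q v S with
      | ⟨some l, v', S'⟩ => ⟨some (f l), v', S'⟩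
      | ⟨none, v', S'⟩ => TM2.stepAux h v' S' := by
  induction q generalizing v S with
  | push _ _ _ ih | peek _ _ _ ih | pop _ _ _ ih | load _ _ ih => exact ih _ _
  | branch g _ _ ih₁ ih₂ => cases hg : g v <;> simp [graft, hg, ih₁, ih₂]
  | goto l => rfl
  | halt => rfl

/-- `RunsIn M n a b`: the machine `M` goes from the configuration `a` to `b` in exactly `n`
steps. -/
inductive RunsIn (M : Λ → TM2.Stmt Γ Λ σ) : ℕ → TM2.Cfg Γ Λ σ → TM2.Cfg Γ Λ σ → Prop
  | refl (c) : RunsIn M 0 c c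
  | step {n l v S c} : RunsIn M n (TM2.stepAux (M l) v S) c → RunsIn M (n + 1) ⟨some l, v, S⟩ c

theorem RunsIn.trans {M : Λ → TM2.Stmt Γ Λ σ} {n m : ℕ} {a b c : TM2.Cfg Γ Λ σ}
    (h : RunsIn M n a b) (h' : RunsIn M m b c) : RunsIn M (n + m) a c := by
  induction h with
  | refl => simpa only [Nat.zero_add] using h'
  | step _ ih => rw [Nat.add_right_comm]; exact .step (ih h')

theorem RunsIn.iterate_eq {M : Λ → TM2.Stmt Γ Λ σ} {n : ℕ} {a b : TM2.Cfg Γ Λ σ}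
    (h : RunsIn M n a b) : (flip bind (TM2.step M))^[n] (some a) = some b := by
  induction h with
  | refl => rfl
  | step _ ih => rw [Function.iterate_succ_apply]; exact ih

theorem RunsIn.graft {M : Λ → TM2.Stmt Γ Λ σ} {M' : Λ' → TM2.Stmt Γ Λ' σ} {f : Λ → Λ'}
    {h : TM2.Stmt Γ Λ' σ} (hM : ∀ l, M' (f l) = graft f h (M l)) {v' : σ} {S' : ∀ k, List (Γ k)}
    {n : ℕ} {l : Λ} {v : σ} {S : ∀ k, List (Γ k)} (r : RunsIn M n ⟨some l, v, S⟩ ⟨none, v', S'⟩) :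
    RunsIn M' n ⟨some (f l), v, S⟩ (TM2.stepAux h v' S') := by
  induction n generalizing l v S with
  | zero => cases r
  | succ n ih =>
    rcases r with _ | r
    refine .step ?_
    rw [hM, stepAux_graft]
    generalize TM2.stepAux (M l) v S = c at r
    obtain ⟨_ | l', w, T⟩ := c
    · cases r; exact .refl _
    · exact ih r

/-- The memory of a machine: the internal state and the stacks. -/
abbrev MachineState (Γ : K → Type) (σ : Type) : Type := σ × ∀ k, List (Γ k)

/-- A program of a stack machine: finitely many labelled statements, and the label to start from. -/
structure Program (Γ : K → Type) (σ : Type) where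
  Label : Type
  [fintypeLabel : Fintype Label]
  code : Label → TM2.Stmt Γ Label σ
  entry : Label

namespace Program

attribute [instance] Program.fintypeLabel

/-- Started in `s`, the program `P` halts in `t` after at most `n` steps. -/
def Runs (P : Program Γ σ) (s t : MachineState Γ σ) (n : ℕ) : Prop :=
  ∃ m ≤ n, RunsIn P.code m ⟨some P.entry, s.1, s.2⟩ ⟨none, t.1, t.2⟩

/-- The program that consists of a single statement. -/
def ofStmt (q : TM2.Stmt Γ Unit σ) : Program Γ σ where
  Label := Unit
  code := fun _ => q
  entry := ()

/-- `P`, then `Q`. -/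
def seq (P Q : Program Γ σ) : Program Γ σ where
  Label := P.Label ⊕ Q.Label
  code := Sum.elim (fun l => graft Sum.inl (.goto fun _ => .inr Q.entry) (P.code l))
    fun l => graft Sum.inr .halt (Q.code l)
  entry := .inl P.entry

/-- `P`, repeated as long as the internal state satisfies `g` afterwards. -/
def doWhile (g : σ → Bool) (P : Program Γ σ) : Program Γ σ where
  Label := P.Label
  code := fun l => graft id (.branch g (.goto fun _ => P.entry) .halt) (P.code l)
  entry := P.entry

/-- `P` if the internal state satisfies `g`, and `Q` otherwise. -/
def ite (g : σ → Bool) (P Q : Program Γ σ) : Program Γ σ where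
  Label := Option (P.Label ⊕ Q.Label)
  code
    | none => .goto fun v => if g v then some (.inl P.entry) else some (.inr Q.entry)
    | some (.inl l) => graft (some ∘ Sum.inl) .halt (P.code l)
    | some (.inr l) => graft (some ∘ Sum.inr) .halt (Q.code l)
  entry := none

variable {P Q : Program Γ σ} {g : σ → Bool} {s t u : MachineState Γ σ} {n m : ℕ}

theorem Runs.mono (h : P.Runs s t n) (hnm : n ≤ m) : P.Runs s t m :=
  let ⟨k, hk, r⟩ := h
  ⟨k, hk.trans hnm, r⟩

theorem runs_ofStmt {q : TM2.Stmt Γ Unit σ} (h : TM2.stepAux q s.1 s.2 = ⟨none, t.1, t.2⟩) :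
    (ofStmt q).Runs s t 1 :=
  ⟨1, le_rfl, .step (h ▸ .refl _)⟩

theorem Runs.seq (hP : P.Runs s t n) (hQ : Q.Runs t u m) : (P.seq Q).Runs s u (n + m) := by
  obtain ⟨n', hn, r⟩ := hP
  obtain ⟨m', hm, r'⟩ := hQ
  exact ⟨n' + m', Nat.add_le_add hn hm, .trans
    (RunsIn.graft (M' := (P.seq Q).code) (f := Sum.inl) (fun _ => rfl) r)
    (RunsIn.graft (M' := (P.seq Q).code) (f := Sum.inr) (fun _ => rfl) r')⟩

theorem Runs.doWhile_last (h : P.Runs s t n) (hg : g t.1 = false) :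
    (P.doWhile g).Runs s t n := by
  obtain ⟨n', hn, r⟩ := h
  have r' := RunsIn.graft (M' := (P.doWhile g).code) (f := id) (fun _ => rfl) r
  simp only [TM2.stepAux, hg, cond_false] at r'
  exact ⟨n', hn, r'⟩

theorem Runs.doWhile_next (h : P.Runs s t n) (hg : g t.1 = true)
    (h' : (P.doWhile g).Runs t u m) : (P.doWhile g).Runs s u (n + m) := by
  obtain ⟨n', hn, r⟩ := h
  obtain ⟨m', hm, r'⟩ := h'
  have r₁ := RunsIn.graft (M' := (P.doWhile g).code) (f := id) (fun _ => rfl) r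
  simp only [TM2.stepAux, hg, cond_true] at r₁
  exact ⟨n' + m', Nat.add_le_add hn hm, r₁.trans r'⟩

theorem Runs.ite_true (h : P.Runs s t n) (hg : g s.1 = true) : (ite g P Q).Runs s t (n + 1) := by
  obtain ⟨n', hn, r⟩ := h
  refine ⟨n' + 1, Nat.add_le_add_right hn 1, .step ?_⟩
  simpa [ite, hg] using
    RunsIn.graft (M' := (ite g P Q).code) (f := some ∘ Sum.inl) (fun _ => rfl) r

theorem Runs.ite_false (h : Q.Runs s t n) (hg : g s.1 = false) : (ite g P Q).Runs s t (n + 1) := by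
  obtain ⟨n', hn, r⟩ := h
  refine ⟨n' + 1, Nat.add_le_add_right hn 1, .step ?_⟩
  simpa [ite, hg] using
    RunsIn.graft (M' := (ite g P Q).code) (f := some ∘ Sum.inr) (fun _ => rfl) r

end Program

end Machine

/-! ### The memory of the decision procedure -/

/-- Letters of a word, each carrying a mark. -/
abbrev Cell : Type := Γ' × Bool

/-- The variables of the conditions to be evaluated. They range over the suffixes of the input
word, which is the value of variable `0`. -/
abbrev Var : Type := Fin 10

/-- Working stacks: a counter of rounds, the word under construction, the letters that the left and
the right head have already read, and the variables. -/
inductive Mem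
  | counter
  | result
  | trailL
  | trailR
  | var (i : Var)
  deriving DecidableEq, Fintype

/-- Stacks: the input, the output and the working stacks. -/
inductive Stk
  | inp
  | out
  | mem (x : Mem)
  deriving DecidableEq, Fintype

/-- The alphabets of the stacks. -/
abbrev Sym : Stk → Type
  | .inp => Γ'
  | .out => Bool
  | .mem _ => Cell

/-- Internal states: the truth value computed last, whether to repeat the current loop, and a buffer
for each head. -/
structure Ctl where
  flag : Bool
  go : Bool
  bufL : Option Cell
  bufR : Option Cell
  deriving Fintype

/-- The contents of all stacks. -/
def pack (i : List Γ') (o : List Bool) (M : Mem → List Cell) : ∀ k, List (Sym k)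
  | .inp => i
  | .out => o
  | .mem x => M x

section pack

variable (i : List Γ') (o : List Bool) (M : Mem → List Cell)

@[simp] theorem pack_inp : pack i o M .inp = i := rfl
@[simp] theorem pack_out : pack i o M .out = o := rfl
@[simp] theorem pack_mem (x : Mem) : pack i o M (.mem x) = M x := rfl

@[simp] theorem update_pack_mem (x : Mem) (l : List Cell) :
    Function.update (pack i o M) (.mem x) l = pack i o (Function.update M x l) := by
  funext k
  rcases k with _ | _ | y
  · simp
  · simp
  · by_cases h : y = x
    · subst h; simp
    · simp [h]

@[simp] theorem update_pack_inp (l : List Γ') :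
    Function.update (pack i o M) .inp l = pack l o M := by
  funext k
  rcases k with _ | _ | y <;> simp

@[simp] theorem update_pack_out (l : List Bool) :
    Function.update (pack i o M) .out l = pack i l M := by
  funext k
  rcases k with _ | _ | y <;> simp

end pack

/-- Memory states between two programs, when the buffers are empty. -/
structure State where
  flag : Bool
  go : Bool
  inp : List Γ'
  out : List Bool
  mem : Mem → List Cell

/-- The memory of the machine in the state `a`. -/
def State.toMachine (a : State) : MachineState Sym Ctl :=
  (⟨a.flag, a.go, none, none⟩, pack a.inp a.out a.mem)

/-- Started in `a`, the program `P` halts in `b` after at most `n` steps. -/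
abbrev Program.Takes (P : Program Sym Ctl) (a b : State) (n : ℕ) : Prop :=
  P.Runs a.toMachine b.toMachine n

/-! ### Moving the contents of a stack -/

/-- Push the letters of `l` one by one on all stacks in `ys`. -/
def pushOn (ys : List Mem) (l : List Cell) (M : Mem → List Cell) : Mem → List Cell :=
  fun z => if z ∈ ys then l.reverse ++ M z else M z

/-- Push the left buffer on all stacks in `ys`. -/
def pushStmt {Λ : Type} (ys : List Mem) (q : TM2.Stmt Sym Λ Ctl) : TM2.Stmt Sym Λ Ctl :=
  ys.foldr (fun y q => .push (.mem y) (fun v => v.bufL.getD default) q) q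

theorem stepAux_pushStmt {Λ : Type} {ys : List Mem} (hys : ys.Nodup) (q : TM2.Stmt Sym Λ Ctl)
    (v : Ctl) (i : List Γ') (o : List Bool) (M : Mem → List Cell) :
    TM2.stepAux (pushStmt ys q) v (pack i o M) =
      TM2.stepAux q v (pack i o (pushOn ys [v.bufL.getD default] M)) := by
  induction ys generalizing M with
  | nil => rfl
  | cons y ys ih =>
    obtain ⟨hy, hys⟩ := List.nodup_cons.1 hys
    change TM2.stepAux (.push (.mem y) _ (pushStmt ys q)) _ _ = _
    rw [TM2.stepAux, update_pack_mem, ih hys]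
    congr 2
    funext z
    by_cases hz : z = y
    · subst hz; simp [pushOn, hy]
    · simp [pushOn, hz]

/-- Move the contents of `x` to all stacks in `ys`, which reverses it. -/
def drain (x : Mem) (ys : List Mem) : Program Sym Ctl :=
  .doWhile Ctl.go <| .ofStmt <|
    .pop (.mem x) (fun v a => { v with bufL := a, go := a.isSome }) <|
    .branch Ctl.go (pushStmt ys (.load (fun v => { v with bufL := none }) .halt)) .halt

theorem takes_drain {x : Mem} {ys : List Mem} (hx : x ∉ ys) (hys : ys.Nodup) {a : State}
    {l : List Cell} (hl : a.mem x = l) :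
    (drain x ys).Takes a
      { a with go := false, mem := Function.update (pushOn ys l a.mem) x [] } (l.length + 1) := by
  induction l generalizing a with
  | nil =>
    have : pushOn ys [] a.mem = a.mem := by funext z; simp [pushOn]
    exact .doWhile_last (Program.runs_ofStmt (by simp [State.toMachine, hl, this])) rfl
  | cons c l ih =>
    have rest := ih (a := { a with go := true, mem := pushOn ys [c] (Function.update a.mem x l) })
      (by simp [pushOn, hx])
    have drained : Function.update (pushOn ys (c :: l) a.mem) x [] =
        Function.update (pushOn ys l (pushOn ys [c] (Function.update a.mem x l))) x [] := by
      funext z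
      by_cases hz : z = x
      · simp [hz]
      · by_cases hy : z ∈ ys <;> simp [pushOn, hz, hy]
    rw [List.length_cons, Nat.add_comm, drained]
    refine .doWhile_next (Program.runs_ofStmt ?_) rfl rest
    simp [State.toMachine, hl, stepAux_pushStmt hys]

theorem takes_clear (x : Mem) (a : State) :
    (drain x []).Takes a { a with go := false, mem := Function.update a.mem x [] }
      ((a.mem x).length + 1) := by
  have := takes_drain (x := x) (ys := []) (by simp) (by simp) (a := a) rfl
  rwa [show pushOn [] (a.mem x) a.mem = a.mem by funext z; simp [pushOn]] at this

theorem takes_move {x y : Mem} (h : x ≠ y) {a : State} {l : List Cell} (hl : a.mem x = l) :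
    (drain x [y]).Takes a
      { a with
        go := false
        mem := Function.update (Function.update a.mem x []) y (l.reverse ++ a.mem y) }
      (l.length + 1) := by
  have := takes_drain (ys := [y]) (by simpa using h) (by simp) hl
  rwa [show pushOn [y] l a.mem = Function.update a.mem y (l.reverse ++ a.mem y) by
    funext z; by_cases hz : z = y <;> simp [pushOn, hz], Function.update_comm h.symm] at this

/-- Copy the input word to the variable `k`. -/
def copy (k : Var) : Program Sym Ctl :=
  (drain (.var 0) [.trailL]).seq (drain .trailL [.var 0, .var k])

theorem takes_copy {k : Var} (hk : k ≠ 0) {a : State} (hL : a.mem .trailL = [])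
    (hV : a.mem (.var k) = []) :
    (copy k).Takes a
      { a with go := false, mem := Function.update a.mem (.var k) (a.mem (.var 0)) }
      (2 * (a.mem (.var 0)).length + 2) := by
  have copied : Function.update a.mem (.var k) (a.mem (.var 0)) =
      Function.update (pushOn [.var 0, .var k] (a.mem (.var 0)).reverse
        (Function.update (pushOn [.trailL] (a.mem (.var 0)) a.mem) (.var 0) [])) .trailL [] := by
    funext x
    rcases x with _ | _ | _ | _ | j
    · simp [pushOn]
    · simp [pushOn]
    · simp [hL]
    · simp [pushOn]
    · by_cases hj : j = k
      · subst hj; simp [pushOn, hV, hk]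
      · by_cases hj0 : j = 0
        · subst hj0; simp [pushOn, hk.symm]
        · simp [pushOn, hj, hj0]
  rw [copied]
  refine .mono (.seq (takes_drain (by simp) (by simp) rfl)
    (takes_drain (by simp) (by simpa using hk.symm) (by simp [pushOn, hL]))) ?_
  simp
  omega

/-! ### Two-head automata -/

/-- A move of a two-head automaton: it answers, or advances one head and changes its state. -/
inductive Action (Q : Type)
  | answer (b : Bool)
  | left (q : Q)
  | right (q : Q)

/-- The transitions of a two-head automaton, which sees the next letters of both words. -/
abbrev Transitions (Q : Type) : Type := Q → Option Cell → Option Cell → Action Q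

/-- From the state `q`, the automaton with the transitions `δ` answers `b` to the words `s` and
`t`. -/
inductive Scan {Q : Type} (δ : Transitions Q) : Q → List Cell → List Cell → Bool → Prop
  | answer {q s t b} : δ q s.head? t.head? = .answer b → Scan δ q s t b
  | left {q q' c s t b} : δ q (some c) t.head? = .left q' → Scan δ q' s t b → Scan δ q (c :: s) t b
  | right {q q' c s t b} : δ q s.head? (some c) = .right q' → Scan δ q' s t b →
      Scan δ q s (c :: t) b

/-- The given answer, if any. -/
def Action.answer? {Q : Type} : Action Q → Option Bool
  | .answer b => some b
  | _ => none

/-- Whether the left head advances. -/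
def Action.isLeft {Q : Type} : Action Q → Bool
  | .left _ => true
  | _ => false

/-- The state after the move, when the present state is `q`. -/
def Action.next {Q : Type} (q : Q) : Action Q → Q
  | .answer _ => q
  | .left q' | .right q' => q'

/-- One move of a two-head automaton on the variables `i` and `j`. -/
def scanStmt {Q : Type} (δ : Transitions Q) (i j : Var) (q : Q) : TM2.Stmt Sym Q Ctl :=
  .peek (.mem (.var i)) (fun v c => { v with bufL := c }) <|
  .peek (.mem (.var j)) (fun v c => { v with bufR := c }) <|
  .branch (fun v => (δ q v.bufL v.bufR).answer?.isSome)
    (.load (fun v => ⟨(δ q v.bufL v.bufR).answer?.getD false, false, none, none⟩) .halt) <|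
  .branch (fun v => (δ q v.bufL v.bufR).isLeft)
    (.pop (.mem (.var i)) (fun v _ => v) <| .push (.mem .trailL) (fun v => v.bufL.getD default) <|
      .goto fun v => (δ q v.bufL v.bufR).next q)
    (.pop (.mem (.var j)) (fun v _ => v) <| .push (.mem .trailR) (fun v => v.bufR.getD default) <|
      .goto fun v => (δ q v.bufL v.bufR).next q)

/-- The memory with the letters that the heads on `i` and `j` have read put back in place. -/
def rewind (i j : Var) (M : Mem → List Cell) : Mem → List Cell
  | .trailL | .trailR => []
  | .var k =>
    if k = i then (M .trailL).reverse ++ M (.var i)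
    else if k = j then (M .trailR).reverse ++ M (.var j) else M (.var k)
  | x => M x

theorem rewind_of_trails_nil {i j : Var} {M : Mem → List Cell} (hL : M .trailL = [])
    (hR : M .trailR = []) : rewind i j M = M := by
  funext x
  rcases x with _ | _ | _ | _ | k <;> simp only [rewind, hL, hR]
  split_ifs with hi hj <;> simp [*]

theorem rewind_advance_left {i j : Var} (hij : i ≠ j) {M : Mem → List Cell} {c : Cell}
    {s : List Cell} (hM : M (.var i) = c :: s) :
    rewind i j (Function.update (Function.update M (.var i) s) .trailL (c :: M .trailL)) =
      rewind i j M := by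
  funext x
  rcases x with _ | _ | _ | _ | k <;> simp only [rewind]
  · simp
  · simp
  · split_ifs with hi hj
    · simp [hM]
    · simp [hij.symm]
    · simp [hi]

theorem rewind_advance_right {i j : Var} (hij : i ≠ j) {M : Mem → List Cell} {c : Cell}
    {s : List Cell} (hM : M (.var j) = c :: s) :
    rewind i j (Function.update (Function.update M (.var j) s) .trailR (c :: M .trailR)) =
      rewind i j M := by
  funext x
  rcases x with _ | _ | _ | _ | k <;> simp only [rewind]
  · simp
  · simp
  · split_ifs with hi hj
    · simp [hij]
    · simp [hM]
    · simp [hj]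

theorem Scan.runsIn {Q : Type} {δ : Transitions Q} {i j : Var} (hij : i ≠ j) {q : Q}
    {s t : List Cell} {b : Bool} (h : Scan δ q s t b) {M : Mem → List Cell}
    (hs : M (.var i) = s) (ht : M (.var j) = t) (v : Ctl) (ip : List Γ') (o : List Bool) :
    ∃ n ≤ s.length + t.length + 1, ∃ M', rewind i j M' = rewind i j M ∧
      RunsIn (scanStmt δ i j) n ⟨some q, v, pack ip o M⟩
        ⟨none, ⟨b, false, none, none⟩, pack ip o M'⟩ := by
  induction h generalizing M v with
  | answer h =>
    refine ⟨1, by omega, M, rfl, .step ?_⟩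
    simp only [scanStmt, TM2.stepAux, pack_mem, hs, ht, h, Action.answer?, Option.isSome_some,
      cond_true, Option.getD_some]
    exact .refl _
  | @left q q' c s t b h _ ih =>
    obtain ⟨n, hn, M', hM, r⟩ := ih
      (M := Function.update (Function.update M (.var i) s) .trailL (c :: M .trailL))
      (by simp) (by simp [ht, hij.symm]) { v with bufL := some c, bufR := t.head? }
    refine ⟨n + 1, by simp only [List.length_cons]; omega, M',
      hM.trans (rewind_advance_left hij hs), .step ?_⟩
    simpa [scanStmt, hs, ht, h, Action.answer?, Action.isLeft, Action.next] using r
  | @right q q' c s t b h _ ih =>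
    obtain ⟨n, hn, M', hM, r⟩ := ih
      (M := Function.update (Function.update M (.var j) t) .trailR (c :: M .trailR))
      (by simp [hs, hij]) (by simp) { v with bufL := s.head?, bufR := some c }
    refine ⟨n + 1, by simp only [List.length_cons]; omega, M',
      hM.trans (rewind_advance_right hij ht), .step ?_⟩
    simpa [scanStmt, hs, ht, h, Action.answer?, Action.isLeft, Action.next] using r

/-- Run the automaton with the transitions `δ` on the variables `i` and `j`, then rewind. -/
def scan {Q : Type} [Fintype Q] (δ : Transitions Q) (q₀ : Q) (i j : Var) : Program Sym Ctl :=
  Program.seq ⟨Q, scanStmt δ i j, q₀⟩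
    ((drain .trailL [.var i]).seq (drain .trailR [.var j]))

theorem takes_scan {Q : Type} [Fintype Q] {δ : Transitions Q} {q₀ : Q} {i j : Var} (hij : i ≠ j)
    {a : State} (hL : a.mem .trailL = []) (hR : a.mem .trailR = []) {b : Bool}
    (h : Scan δ q₀ (a.mem (.var i)) (a.mem (.var j)) b) :
    (scan δ q₀ i j).Takes a { a with flag := b, go := false }
      (2 * (a.mem (.var i)).length + 2 * (a.mem (.var j)).length + 3) := by
  obtain ⟨n, hn, M, hM, r⟩ := h.runsIn hij rfl rfl ⟨a.flag, a.go, none, none⟩ a.inp a.out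
  rw [rewind_of_trails_nil hL hR] at hM
  have rewound : a.mem = Function.update (pushOn [.var j] (M .trailR)
      (Function.update (pushOn [.var i] (M .trailL) M) .trailL [])) .trailR [] := by
    rw [← hM]
    funext x
    rcases x with _ | _ | _ | _ | k <;> simp only [rewind]
    · simp [pushOn]
    · simp [pushOn]
    · simp [pushOn]
    · simp
    · split_ifs with hi hj
      · simp [pushOn, hi, hij]
      · simp [pushOn, hj, hij.symm]
      · simp [pushOn, hi, hj]
  have hi : (M .trailL).length ≤ (a.mem (.var i)).length := by simp [← hM, rewind]
  have hj : (M .trailR).length ≤ (a.mem (.var j)).length := by simp [← hM, rewind, hij.symm]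
  have scanned : Program.Runs ⟨Q, scanStmt δ i j, q₀⟩ a.toMachine
      (State.toMachine { a with flag := b, go := false, mem := M }) n := ⟨n, le_rfl, r⟩
  have restored := scanned.seq <| .seq
    (takes_drain (x := .trailL) (ys := [.var i]) (by simp) (by simp) rfl)
    (takes_drain (x := .trailR) (ys := [.var j]) (l := M .trailR) (by simp) (by simp)
      (by simp [pushOn]))
  rw [← rewound] at restored
  exact restored.mono (by simp only; omega)

/-! ### Predicates decided in polynomial time -/

/-- Nothing has been read, the variables from `k` on are empty, and the others have length at most
`N`. -/
structure Clean (k N : ℕ) (M : Mem → List Cell) : Prop where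
  trailL : M .trailL = []
  trailR : M .trailR = []
  var_eq_nil : ∀ i : Var, k ≤ i → M (.var i) = []
  length_le : ∀ i, (M (.var i)).length ≤ N

theorem Clean.mono {k k' N : ℕ} {M : Mem → List Cell} (h : Clean k N M) (hk : k ≤ k') :
    Clean k' N M :=
  { h with var_eq_nil := fun i hi => h.var_eq_nil i (hk.trans hi) }

theorem Clean.update_var {N : ℕ} {k : Var} {M : Mem → List Cell} (h : Clean (k + 1) N M)
    {l : List Cell} (hl : l.length ≤ N) : Clean (k + 1) N (Function.update M (.var k) l) where
  trailL := by simpa using h.trailL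
  trailR := by simpa using h.trailR
  var_eq_nil i hi := by
    have hik : i ≠ k := by rintro rfl; omega
    simpa [hik] using h.var_eq_nil i hi
  length_le i := by
    by_cases hik : i = k
    · simpa [hik] using hl
    · simpa [hik] using h.length_le i

/-- The values of the variables. -/
def vars (M : Mem → List Cell) : Var → List Cell := fun i => M (.var i)

theorem vars_update_var (M : Mem → List Cell) (k : Var) (l : List Cell) :
    vars (Function.update M (.var k) l) = Function.update (vars M) k l :=
  Function.update_comp_eq_of_injective M (fun _ _ => Mem.var.inj) k l

open Classical in
/-- The program `prog` evaluates the predicate `P` of the variables in time `p`, using the variables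
from `k` on as scratch space. -/
def Program.Decides (prog : Program Sym Ctl) (k : ℕ) (P : (Var → List Cell) → Prop)
    (p : Polynomial ℕ) : Prop :=
  ∀ ⦃N a⦄, Clean k N a.mem →
    prog.Takes a { a with flag := decide (P (vars a.mem)), go := false } (p.eval N)

/-- The predicate `P` of the variables is decided in polynomial time by a program that uses the
variables from `k` on as scratch space. -/
def Dec (k : ℕ) (P : (Var → List Cell) → Prop) : Prop :=
  ∃ prog p, Program.Decides prog k P p

section Dec

variable {k : ℕ} {P Q : (Var → List Cell) → Prop}

theorem Dec.congr_of_empty (h : Dec k P)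
    (hPQ : ∀ V, (∀ i : Var, k ≤ i → V i = []) → (P V ↔ Q V)) : Dec k Q := by
  obtain ⟨prog, p, h⟩ := h
  refine ⟨prog, p, fun N a ha => ?_⟩
  rw [← decide_eq_decide.2 (hPQ (vars a.mem) ha.var_eq_nil)]
  exact h ha

theorem Dec.congr (h : Dec k P) (hPQ : ∀ V, P V ↔ Q V) : Dec k Q :=
  h.congr_of_empty fun V _ => hPQ V

theorem Dec.scan {S : Type} [Finite S] (δ : Transitions S) (q₀ : S) {i j : Var} (hij : i ≠ j)
    {R : List Cell → List Cell → Prop} [∀ s t, Decidable (R s t)]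
    (h : ∀ s t, Scan δ q₀ s t (decide (R s t))) : Dec k fun V => R (V i) (V j) := by
  have := Fintype.ofFinite S
  refine ⟨CQA.scan δ q₀ i j, 4 * .X + 3, fun N a ha => ?_⟩
  refine .mono (takes_scan hij ha.trailL ha.trailR (by convert h _ _; rfl)) ?_
  have := ha.length_le i
  have := ha.length_le j
  simp
  omega

theorem Dec.const (k : ℕ) (c : Prop) : Dec k fun _ => c := by
  classical
  refine ⟨.ofStmt (.load (fun v => { v with flag := decide c, go := false }) .halt), 1,
    fun N a _ => ?_⟩
  rw [Polynomial.eval_one]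
  exact Program.runs_ofStmt (by simp [State.toMachine])

theorem Dec.not (h : Dec k P) : Dec k fun V => ¬ P V := by
  classical
  obtain ⟨prog, p, h⟩ := h
  refine ⟨prog.seq (.ofStmt (.load (fun v => { v with flag := !v.flag }) .halt)), p + 1,
    fun N a ha => ?_⟩
  rw [Polynomial.eval_add, Polynomial.eval_one]
  exact (h ha).seq (Program.runs_ofStmt (by simp [State.toMachine]))

theorem Dec.and (hP : Dec k P) (hQ : Dec k Q) : Dec k fun V => P V ∧ Q V := by
  classical
  obtain ⟨prog, p, hP⟩ := hP
  obtain ⟨prog', q, hQ⟩ := hQ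
  refine ⟨prog.seq (.ite Ctl.flag prog' (.ofStmt .halt)), p + (q + 1 + 1), fun N a ha => ?_⟩
  simp only [Polynomial.eval_add, Polynomial.eval_one]
  refine (hP ha).seq ?_
  by_cases h : P (vars a.mem)
  · simp only [h, true_and, decide_true]
    exact .mono (.ite_true (hQ (a := { a with flag := true, go := false }) ha) rfl) (by omega)
  · simp only [h, false_and, decide_false]
    exact .mono (.ite_false (Program.runs_ofStmt rfl) rfl) (by omega)

theorem Dec.or (hP : Dec k P) (hQ : Dec k Q) : Dec k fun V => P V ∨ Q V :=
  (hP.not.and hQ.not).not.congr fun V => by tauto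

theorem Dec.imp (hP : Dec k P) (hQ : Dec k Q) : Dec k fun V => P V → Q V :=
  (hP.not.or hQ).congr fun V => by tauto

theorem Dec.iff (hP : Dec k P) (hQ : Dec k Q) : Dec k fun V => P V ↔ Q V :=
  ((hP.imp hQ).and (hQ.imp hP)).congr fun V => by tauto

theorem Dec.exists_mem {β : Type} {s : Set β} (hs : s.Finite) {R : β → (Var → List Cell) → Prop}
    (h : ∀ b ∈ s, Dec k (R b)) : Dec k fun V => ∃ b ∈ s, R b V := by
  induction s, hs using Set.Finite.induction_on with
  | empty => exact (Dec.const k False).congr fun V => by simp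
  | insert _ _ ih =>
    exact ((h _ (Set.mem_insert _ _)).or
      (ih fun b hb => h b (Set.mem_insert_of_mem _ hb))).congr fun V => by simp

theorem Dec.forall_mem {β : Type} {s : Set β} (hs : s.Finite) {R : β → (Var → List Cell) → Prop}
    (h : ∀ b ∈ s, Dec k (R b)) : Dec k fun V => ∀ b ∈ s, R b V :=
  (Dec.exists_mem hs fun b hb => (h b hb).not).not.congr fun V => by simp

end Dec

/-! ### Quantification over the suffixes of the input word -/

/-- Empty the variable `k` if the truth value is true. Otherwise remove its first letter, and repeat
if there was one. -/
def advance (k : Var) : Program Sym Ctl :=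
  .ite Ctl.flag (drain (.var k) [])
    (.ofStmt (.pop (.mem (.var k)) (fun v c => { v with go := c.isSome }) .halt))

/-- Run `prog` on the suffixes of the variable `k` until it answers true, then empty `k`. -/
def search (prog : Program Sym Ctl) (k : Var) : Program Sym Ctl :=
  .doWhile Ctl.go (prog.seq (advance k))

theorem takes_advance_found {k : Var} {a : State} (ha : a.flag = true) :
    (advance k).Takes a { a with go := false, mem := Function.update a.mem (.var k) [] }
      ((a.mem (.var k)).length + 2) :=
  (takes_clear (.var k) a).ite_true ha

theorem takes_advance {k : Var} {a : State} (ha : a.flag = false) :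
    (advance k).Takes a
      { a with
        go := (a.mem (.var k)).head?.isSome
        mem := Function.update a.mem (.var k) (a.mem (.var k)).tail } 2 :=
  .ite_false (Program.runs_ofStmt (by simp [State.toMachine])) ha

open Classical in
theorem takes_search {prog : Program Sym Ctl} {k : Var} {P : (Var → List Cell) → Prop}
    {p : Polynomial ℕ} (h : prog.Decides (k + 1) P p) {N : ℕ} {a : State}
    (ha : Clean (k + 1) N a.mem) {l : List Cell} (hl : a.mem (.var k) = l) :
    (search prog k).Takes a
      { a with
        flag := decide (∃ t, t <:+ l ∧ P (Function.update (vars a.mem) k t))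
        go := false
        mem := Function.update a.mem (.var k) [] }
      ((l.length + 1) * (p.eval N + (N + 2))) := by
  have self : Function.update (vars a.mem) k l = vars a.mem := by
    rw [← hl]; exact Function.update_eq_self k (vars a.mem)
  have hlN : l.length ≤ N := hl ▸ ha.length_le k
  by_cases hP : P (vars a.mem)
  · rw [decide_eq_true ⟨l, List.suffix_rfl, self.symm ▸ hP⟩]
    have first := (h ha).seq (takes_advance_found (k := k) (by simp [hP]))
    simp only [hP, decide_true, hl] at first
    exact (Program.Runs.doWhile_last (g := Ctl.go) first rfl).mono (by nlinarith)
  have first := (h ha).seq (takes_advance (k := k) (by simp [hP]))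
  simp only [hP, decide_false, hl] at first
  match l with
  | [] =>
    have none : ¬ ∃ t, t <:+ [] ∧ P (Function.update (vars a.mem) k t) := by
      rintro ⟨t, ht, hPt⟩
      rw [List.suffix_nil.1 ht, self] at hPt
      exact hP hPt
    rw [decide_eq_false none]
    exact (Program.Runs.doWhile_last (g := Ctl.go) first rfl).mono (by simp)
  | c :: l =>
    have later : (∃ t, t <:+ c :: l ∧ P (Function.update (vars a.mem) k t)) ↔
        ∃ t, t <:+ l ∧ P (Function.update (vars a.mem) k t) := by
      simp only [List.suffix_cons_iff, or_and_right, exists_or, exists_eq_left, self, hP, false_or]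
    have rest := takes_search h (l := l)
      (a := { a with flag := false, go := true, mem := Function.update a.mem (.var k) l })
      (ha.update_var (by simp at hlN; omega)) (by simp)
    simp only [vars_update_var, Function.update_idem] at rest
    rw [decide_eq_decide.2 later]
    refine (Program.Runs.doWhile_next (g := Ctl.go) first rfl rest).mono ?_
    rw [List.length_cons]
    nlinarith
termination_by l.length

theorem Dec.exists (k : Var) (hk : k ≠ 0) {P : (Var → List Cell) → List Cell → Prop}
    (h : Dec (k + 1) fun V => P V (V k)) (hP : ∀ V s, P (Function.update V k s) s ↔ P V s) :
    Dec k fun V => ∃ s, s <:+ V 0 ∧ P V s := by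
  obtain ⟨prog, p, h⟩ := h
  refine ⟨(copy k).seq (search prog k), 2 * .X + 2 + (.X + 1) * (p + (.X + 2)), fun N a ha => ?_⟩
  have hk0 : a.mem (.var k) = [] := ha.var_eq_nil k le_rfl
  have hN : (a.mem (.var 0)).length ≤ N := ha.length_le 0
  have searched := (takes_copy hk ha.trailL hk0).seq <|
    takes_search h ((ha.mono (Nat.le_succ _)).update_var hN) (Function.update_self ..)
  rw [Function.update_idem, ← hk0, Function.update_eq_self] at searched
  have found : (∃ t, t <:+ a.mem (.var 0) ∧ P (Function.update (vars
      (Function.update a.mem (.var k) (a.mem (.var 0)))) k t) (Function.update (vars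
      (Function.update a.mem (.var k) (a.mem (.var 0)))) k t k)) ↔
      ∃ t, t <:+ a.mem (.var 0) ∧ P (vars a.mem) t := by
    simp only [vars_update_var, Function.update_self, Function.update_idem, hP]
  rw [decide_eq_decide.2 found] at searched
  refine searched.mono ?_
  simp only [Polynomial.eval_add, Polynomial.eval_mul, Polynomial.eval_X, Polynomial.eval_one,
    Polynomial.eval_ofNat]
  gcongr

theorem Dec.forall (k : Var) (hk : k ≠ 0) {P : (Var → List Cell) → List Cell → Prop}
    (h : Dec (k + 1) fun V => P V (V k)) (hP : ∀ V s, P (Function.update V k s) s ↔ P V s) :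
    Dec k fun V => ∀ s, s <:+ V 0 → P V s :=
  (Dec.exists (P := fun V s => ¬ P V s) k hk h.not fun V s => not_congr (hP V s)).not.congr
    fun V => by simp

/-! ### Rounds of marking -/

open Classical in
/-- Mark the suffix `s` of `w` wherever `φ` holds. -/
noncomputable def remark (φ : List Cell → List Cell → Prop) (w : List Cell) : List Cell → List Cell
  | [] => []
  | c :: s => (c.1, decide (φ w (c :: s))) :: remark φ w s

@[simp] theorem length_remark (φ : List Cell → List Cell → Prop) (w s : List Cell) :
    (remark φ w s).length = s.length := by
  induction s with
  | nil => rfl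
  | cons c s ih => simp [remark, ih]

theorem length_iterate_remark (φ : List Cell → List Cell → Prop) (n : ℕ) (w : List Cell) :
    ((fun w => remark φ w w)^[n] w).length = w.length := by
  induction n with
  | zero => rfl
  | succ n ih => rw [Function.iterate_succ_apply', length_remark, ih]

/-- Move the letters of variable `1`, marked by the answers of `prog`, to the result. -/
def markLetters (prog : Program Sym Ctl) : Program Sym Ctl :=
  .doWhile Ctl.go <| prog.seq <| .ofStmt <|
    .pop (.mem (.var 1)) (fun v c => { v with bufL := c, go := c.isSome }) <|
    .branch Ctl.go
      (.push (.mem .result) (fun v => ((v.bufL.getD default).1, v.flag)) <|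
        .load (fun v => { v with flag := false, bufL := none }) .halt)
      (.load (fun v => { v with flag := false }) .halt)

/-- Mark every letter of the input word by the answer of `prog` to the suffix that it starts. -/
def markRound (prog : Program Sym Ctl) : Program Sym Ctl :=
  (copy 1).seq <| (markLetters prog).seq <| (drain (.var 0) []).seq (drain .result [.var 0])

/-- Marking rounds: one, and another one for each letter of the counter. -/
def markRounds (prog : Program Sym Ctl) : Program Sym Ctl :=
  .doWhile Ctl.go <| (markRound prog).seq <| .ofStmt <|
    .pop (.mem .counter) (fun v c => { v with go := c.isSome }) .halt

section Rounds

variable {prog : Program Sym Ctl} {φ : List Cell → List Cell → Prop} {p : Polynomial ℕ} {N : ℕ}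

theorem takes_markLetters (h : prog.Decides 2 (fun V => φ (V 0) (V 1)) p) {a : State}
    (ha : Clean 2 N a.mem) {l : List Cell} (hl : a.mem (.var 1) = l) :
    (markLetters prog).Takes a
      { a with
        flag := false
        go := false
        mem := Function.update (Function.update a.mem (.var 1) []) .result
          ((remark φ (a.mem (.var 0)) l).reverse ++ a.mem .result) }
      ((l.length + 1) * (p.eval N + 1)) := by
  classical
  induction l generalizing a with
  | nil =>
    have clear : Function.update a.mem (.var 1) [] = a.mem := by
      rw [← hl, Function.update_eq_self]
    refine .mono (.doWhile_last ((h ha).seq (Program.runs_ofStmt ?_)) rfl) (by simp)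
    simp [State.toMachine, hl, remark, clear]
  | cons c l ih =>
    let M := Function.update (Function.update a.mem (.var 1) l) .result
      ((c.1, decide (φ (a.mem (.var 0)) (c :: l))) :: a.mem .result)
    have hlN : l.length ≤ N := by
      have := ha.length_le 1
      simp only [hl, List.length_cons] at this
      omega
    have hM := ha.update_var (k := 1) hlN
    have rest := ih (a := { a with flag := false, go := true, mem := M })
      ⟨hM.trailL, hM.trailR, hM.var_eq_nil, hM.length_le⟩ (by simp [M])
    have marked : Function.update (Function.update M (.var 1) []) .result
        ((remark φ (M (.var 0)) l).reverse ++ M .result) =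
        Function.update (Function.update a.mem (.var 1) []) .result
          ((remark φ (a.mem (.var 0)) (c :: l)).reverse ++ a.mem .result) := by
      funext x
      rcases x with _ | _ | _ | _ | i
      all_goals try simp [M, remark]
      by_cases hi : i = 1 <;> simp [hi]
    rw [marked] at rest
    refine .mono (.doWhile_next ((h ha).seq (Program.runs_ofStmt ?_)) rfl rest)
      (by rw [List.length_cons]; nlinarith)
    simp [State.toMachine, hl, M, vars]

theorem takes_markRound (h : prog.Decides 2 (fun V => φ (V 0) (V 1)) p) {a : State}
    (ha : Clean 1 N a.mem) (hr : a.mem .result = []) :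
    (markRound prog).Takes a
      { a with
        flag := false
        go := false
        mem := Function.update a.mem (.var 0) (remark φ (a.mem (.var 0)) (a.mem (.var 0))) }
      (4 * N + 4 + (N + 1) * (p.eval N + 1)) := by
  have h1 : a.mem (.var 1) = [] := ha.var_eq_nil 1 le_rfl
  have hN : (a.mem (.var 0)).length ≤ N := ha.length_le 0
  let w := remark φ (a.mem (.var 0)) (a.mem (.var 0))
  let M₁ := Function.update a.mem (.var 1) (a.mem (.var 0))
  let M₂ := Function.update a.mem .result w.reverse
  let M₃ := Function.update M₂ (.var 0) []
  have marked := takes_markLetters (a := { a with go := false, mem := M₁ }) h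
    ((ha.mono (Nat.le_succ 1)).update_var (k := 1) hN) (l := a.mem (.var 0)) (by simp [M₁])
  have hM₂ : Function.update (Function.update M₁ (.var 1) []) .result
      ((remark φ (M₁ (.var 0)) (a.mem (.var 0))).reverse ++ M₁ .result) = M₂ := by
    rw [show Function.update M₁ (.var 1) [] = a.mem by rw [Function.update_idem, ← h1,
      Function.update_eq_self]]
    simp [M₁, M₂, w, hr]
  rw [hM₂] at marked
  have moved := takes_move (x := .result) (y := .var 0) (by simp)
    (a := { a with flag := false, go := false, mem := M₃ }) (l := w.reverse) (by simp [M₃, M₂])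
  have hM₄ : Function.update (Function.update M₃ .result []) (.var 0)
      (w.reverse.reverse ++ M₃ (.var 0)) = Function.update a.mem (.var 0) w := by
    funext x
    rcases x with _ | _ | _ | _ | i
    all_goals try simp [M₃, M₂, hr]
    by_cases hi : i = 0 <;> simp [hi]
  rw [hM₄] at moved
  refine Program.Runs.mono ((takes_copy (k := 1) (by simp) ha.trailL h1).seq
    (marked.seq ((takes_clear (.var 0) _).seq moved))) ?_
  simp [M₂, w]
  nlinarith

theorem takes_markRounds (h : prog.Decides 2 (fun V => φ (V 0) (V 1)) p) {a : State}
    (ha : Clean 1 N a.mem) (hr : a.mem .result = []) {l : List Cell} (hl : a.mem .counter = l) :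
    (markRounds prog).Takes a
      { a with
        flag := false
        go := false
        mem := Function.update (Function.update a.mem .counter []) (.var 0)
          ((fun w => remark φ w w)^[l.length + 1] (a.mem (.var 0))) }
      ((l.length + 1) * (4 * N + 4 + (N + 1) * (p.eval N + 1) + 1)) := by
  have first := (takes_markRound h ha hr).seq <| Program.runs_ofStmt
    (q := .pop (.mem .counter) (fun v c => { v with go := c.isSome }) .halt)
    (t := State.toMachine { a with
      flag := false
      go := l.head?.isSome
      mem := Function.update (Function.update a.mem .counter l.tail) (.var 0)
        (remark φ (a.mem (.var 0)) (a.mem (.var 0))) })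
    (by simp [State.toMachine, hl, Function.update_comm (a := Mem.counter) (b := .var 0) (by simp)])
  match l with
  | [] => exact (Program.Runs.doWhile_last (g := Ctl.go) first rfl).mono (by simp)
  | c :: l =>
    have hN : (a.mem (.var 0)).length ≤ N := ha.length_le 0
    let w := remark φ (a.mem (.var 0)) (a.mem (.var 0))
    let M := Function.update (Function.update a.mem .counter l) (.var 0) w
    have hM : Clean 1 N _ := ha.update_var (k := 0) (l := w) (by simpa [w] using hN)
    have rest := takes_markRounds h (l := l) (a := { a with flag := false, go := true, mem := M })
      ⟨hM.trailL, hM.trailR, hM.var_eq_nil, hM.length_le⟩ (by simpa [M] using hr) (by simp [M])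
    have marked : Function.update (Function.update M .counter []) (.var 0)
        ((fun w => remark φ w w)^[l.length + 1] (M (.var 0))) =
        Function.update (Function.update a.mem .counter []) (.var 0)
          ((fun w => remark φ w w)^[(c :: l).length + 1] (a.mem (.var 0))) := by
      funext x
      rcases x with _ | _ | _ | _ | i
      all_goals try simp [M]
      by_cases hi : i = 0 <;> simp [hi, w]
    rw [marked] at rest
    refine (Program.Runs.doWhile_next (g := Ctl.go) first rfl rest).mono ?_
    rw [List.length_cons, Nat.add_mul (l.length + 1), Nat.one_mul, Nat.add_comm]
termination_by l.length

end Rounds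

/-! ### The decision procedure -/

/-- Read the input into a trail, without marks, and as many letters into the counter. -/
def loadTrail : Program Sym Ctl :=
  .doWhile Ctl.go <| .ofStmt <|
    .pop .inp (fun v a => { v with bufL := a.map fun a => (a, false), go := a.isSome }) <|
    .branch Ctl.go
      (pushStmt [.trailL, .counter] (.load (fun v => { v with bufL := none }) .halt)) .halt

/-- Read the input as a word without marks, and as many letters into the counter. -/
def load : Program Sym Ctl := loadTrail.seq (drain .trailL [.var 0])

/-- The memory with the counter `l` and the word `w`. -/
def wordMem (l w : List Cell) : Mem → List Cell :=
  Function.update (Function.update (fun _ => []) .counter l) (.var 0) w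

theorem clean_wordMem {l w : List Cell} : Clean 1 w.length (wordMem l w) := by
  refine ⟨by simp [wordMem], by simp [wordMem], fun i hi => ?_, fun i => ?_⟩
  · have : i ≠ 0 := by rintro rfl; simp at hi
    simp [wordMem, this]
  · by_cases hi : i = 0 <;> simp [wordMem, hi]

/-- The state between two programs with the input `u`, the output `o` and the memory `M`. -/
def State.of (u : List Γ') (o : List Bool) (M : Mem → List Cell) : State := ⟨false, false, u, o, M⟩

theorem takes_loadTrail {a : State} {u : List Γ'} (hu : a.inp = u) :
    loadTrail.Takes a
      { a with
        go := false
        inp := []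
        mem := pushOn [.trailL, .counter] (u.map fun a => (a, false)) a.mem } (u.length + 1) := by
  induction u generalizing a with
  | nil =>
    have : pushOn [.trailL, .counter] [] a.mem = a.mem := by funext z; simp [pushOn]
    exact .doWhile_last (Program.runs_ofStmt (by simp [State.toMachine, hu, this])) rfl
  | cons c u ih =>
    have rest := ih (a := { a with
      go := true
      inp := u
      mem := pushOn [.trailL, .counter] [(c, false)] a.mem }) rfl
    have loaded : pushOn [.trailL, .counter] (u.map fun a => (a, false))
        (pushOn [.trailL, .counter] [(c, false)] a.mem) =
        pushOn [.trailL, .counter] ((c :: u).map fun a => (a, false)) a.mem := by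
      funext z
      by_cases hz : z ∈ [Mem.trailL, .counter] <;> simp [pushOn, hz]
    rw [loaded] at rest
    rw [List.length_cons, Nat.add_comm]
    refine .doWhile_next (Program.runs_ofStmt ?_) rfl rest
    simp [State.toMachine, hu, stepAux_pushStmt (ys := [.trailL, .counter]) (by simp)]

theorem takes_load {u : List Γ'} {w : List Cell} (hw : w = u.map fun a => (a, false)) :
    load.Takes (.of u [] fun _ => []) (.of [] [] (wordMem w.reverse w)) (2 * u.length + 2) := by
  have moved := takes_move (x := .trailL) (y := .var 0) (by simp) (l := w.reverse)
    (a := .of [] [] (pushOn [.trailL, .counter] w fun _ => [])) (by simp [State.of, pushOn])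
  have loaded : Function.update (Function.update (pushOn [.trailL, .counter] w fun _ => [])
      .trailL []) (.var 0) (w.reverse.reverse ++
        pushOn [.trailL, .counter] w (fun _ => []) (.var 0)) = wordMem w.reverse w := by
    funext x
    rcases x with _ | _ | _ | _ | i <;> simp [wordMem, pushOn, Function.update_apply]
  simp only [State.of] at moved
  rw [loaded] at moved
  subst hw
  exact ((takes_loadTrail (a := .of u [] fun _ => []) rfl).seq moved).mono
    (by simp [State.of]; omega)

/-- Load the input, mark it in rounds by `mark`, and output the answer of `eval`. -/
def decideByMarking (mark eval : Program Sym Ctl) : Program Sym Ctl :=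
  load.seq <| (markRounds mark).seq <| eval.seq <| (drain (.var 0) []).seq <|
    .ofStmt <| .push .out (fun v => v.flag) <| .load (fun v => { v with flag := false }) .halt

open Classical in
theorem takes_decideByMarking {mark eval : Program Sym Ctl} {φ : List Cell → List Cell → Prop}
    {ψ : List Cell → Prop} {p q : Polynomial ℕ}
    (hφ : mark.Decides 2 (fun V => φ (V 0) (V 1)) p) (hψ : eval.Decides 1 (fun V => ψ (V 0)) q)
    (u : List Γ') :
    (decideByMarking mark eval).Takes (.of u [] fun _ => [])
      (.of [] [decide (ψ ((fun w => remark φ w w)^[u.length + 1]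
        (u.map fun a => (a, false))))] fun _ => [])
      (3 * u.length + 4 + (u.length + 1) *
        (4 * u.length + 4 + (u.length + 1) * (p.eval u.length + 1) + 1) + q.eval u.length) := by
  let w : List Cell := u.map fun a => (a, false)
  let w' := (fun w => remark φ w w)^[w.length + 1] w
  have hw : w.length = u.length := by simp [w]
  have hw' : w'.length = u.length := (length_iterate_remark ..).trans hw
  have rounds := takes_markRounds hφ (a := .of [] [] (wordMem w.reverse w)) clean_wordMem
    (by simp [State.of, wordMem]) (l := w.reverse) (by simp [State.of, wordMem])
  have marked : Function.update (Function.update (wordMem w.reverse w) .counter []) (.var 0)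
      ((fun w => remark φ w w)^[w.reverse.length + 1] (wordMem w.reverse w (.var 0))) =
      wordMem [] w' := by
    funext x
    rcases x with _ | _ | _ | _ | i
    all_goals try simp [wordMem]
    by_cases hi : i = 0 <;> simp [hi, w']
  simp only [State.of] at rounds
  rw [marked, List.length_reverse] at rounds
  have answered := hψ (a := .of [] [] (wordMem [] w')) clean_wordMem
  have cleared := takes_clear (.var 0)
    { State.of [] [] (wordMem [] w') with flag := decide (ψ w') }
  have empty : Function.update (wordMem [] w') (.var 0) [] = fun _ => [] := by simp [wordMem]
  simp only [State.of] at cleared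
  rw [empty] at cleared
  have written := Program.runs_ofStmt (Γ := Sym) (σ := Ctl)
    (q := .push .out (fun v => v.flag) <| .load (fun v => { v with flag := false }) .halt)
    (s := State.toMachine { State.of [] [] fun _ => [] with flag := decide (ψ w') })
    (t := (State.of [] [decide (ψ w')] fun _ => []).toMachine) (by simp [State.toMachine, State.of])
  rw [← hw]
  refine ((takes_load rfl).seq <| rounds.seq <| answered.seq <| cleared.seq written).mono ?_
  simp only [wordMem, Function.update_self, hw, hw']
  omega

theorem inPTIME_of_dec {α : Type} {enc : α → List Γ'} {L : Set α}
    {φ : List Cell → List Cell → Prop} (hφ : Dec 2 fun V => φ (V 0) (V 1))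
    {ψ : List Cell → Prop} (hψ : Dec 1 fun V => ψ (V 0))
    (hL : ∀ a, a ∈ L ↔ ψ ((fun w => remark φ w w)^[(enc a).length + 1]
      ((enc a).map fun c => (c, false)))) : InPTIME enc L := by
  classical
  obtain ⟨mark, p, hφ⟩ := hφ
  obtain ⟨eval, q, hψ⟩ := hψ
  let prog := decideByMarking mark eval
  let ctl₀ : Ctl := ⟨false, false, none, none⟩
  let tm : FinTM2 :=
    { K := Stk, k₀ := .inp, k₁ := .out, Γ := Sym
      Λ := prog.Label, main := prog.entry, m := prog.code
      σ := Ctl, initialState := ctl₀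
      Γk₀Fin := inferInstanceAs (Fintype Γ') }
  have initList_eq (l : List Γ') :
      initList tm l = ⟨some prog.entry, ctl₀, pack l [] fun _ => []⟩ :=
    congrArg (TM2.Cfg.mk (some prog.entry) ctl₀) <| funext fun k => by
      rcases k with _ | _ | x <;> rfl
  have haltList_eq (l : List Bool) : haltList tm l = ⟨none, ctl₀, pack [] l fun _ => []⟩ :=
    congrArg (TM2.Cfg.mk none ctl₀) <| funext fun k => by rcases k with _ | _ | x <;> rfl
  open Polynomial in
  refine ⟨{
    tm := tm
    inputAlphabet := Equiv.refl _
    outputAlphabet := Equiv.refl _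
    time := 3 * X + 4 + (X + 1) * (4 * X + 4 + (X + 1) * (p + 1) + 1) + q
    outputsFun := fun a => Classical.choice ?_ }⟩
  obtain ⟨n, hn, r⟩ := takes_decideByMarking hφ hψ (enc a)
  simp only [← hL] at r
  refine ⟨⟨⟨n, ?_⟩, hn.trans_eq (by simp)⟩⟩
  refine Eq.trans (congrArg _ (congrArg some ?_)) (r.iterate_eq.trans (congrArg some ?_))
  · exact (initList_eq ((enc a).map id)).trans (by rw [List.map_id]; rfl)
  · exact (haltList_eq [decide (a ∈ L)]).symm

/-! ### Basic predicates of words -/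

/-- The letters of a marked word. -/
abbrev letters (s : List Cell) : List Γ' := s.map Prod.fst

theorem exists_var_ne (i : Var) : ∃ j, i ≠ j := by
  by_cases h : i = 0
  · exact ⟨1, by simp [h]⟩
  · exact ⟨0, h⟩

theorem Dec.fold (k : ℕ) {Q : Type} [Finite Q] (δ : Q → Γ' → Q) (q₀ : Q) (acc : Q → Bool)
    (i : Var) : Dec k fun V => acc ((letters (V i)).foldl δ q₀) = true := by
  obtain ⟨j, hij⟩ := exists_var_ne i
  let δ' : Transitions Q
    | q, none, _ => .answer (acc q)
    | q, some a, _ => .left (δ q a.1)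
  have runs (s t : List Cell) : ∀ q, Scan δ' q s t (acc ((letters s).foldl δ q)) := by
    induction s with
    | nil => exact fun _ => .answer rfl
    | cons a s ih => exact fun _ => .left rfl (ih _)
  refine Dec.scan (R := fun s _ => acc ((letters s).foldl δ q₀) = true) δ' q₀ hij fun s t => ?_
  simpa only [Bool.decide_eq_true] using runs s t q₀

theorem Dec.prefix (k : ℕ) (l : List Γ') (i : Var) : Dec k fun V => l <+: letters (V i) := by
  obtain ⟨j, hij⟩ := exists_var_ne i
  let tail (m : {m // m ∈ l.tails}) : {m // m ∈ l.tails} :=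
    ⟨m.1.tail, (List.mem_tails ..).2 ((List.tail_suffix _).trans ((List.mem_tails ..).1 m.2))⟩
  let δ : Transitions {m // m ∈ l.tails} := fun m a _ =>
    match m.1, a with
    | [], _ => .answer true
    | _ :: _, none => .answer false
    | c :: _, some a => if c = a.1 then .left (tail m) else .answer false
  have runs (s t : List Cell) : ∀ m, Scan δ m s t (decide (m.1 <+: letters s)) := by
    induction s with
    | nil => rintro ⟨_ | ⟨c, m⟩, h⟩ <;> exact .answer (by simp [δ])
    | cons a s ih =>
      rintro ⟨_ | ⟨c, m⟩, h⟩
      · exact .answer (by simp [δ])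
      · by_cases hc : c = a.1
        · refine .left (q' := tail ⟨c :: m, h⟩) (by simp only [δ, if_pos hc]) ?_
          simpa [hc, tail] using ih (tail ⟨c :: m, h⟩)
        · exact .answer (by simp [δ, hc])
  exact Dec.scan (R := fun s _ => l <+: letters s) δ ⟨l, by simp⟩ hij fun s t => runs s t _

/-- The first letter carries a mark. -/
def Marked (s : List Cell) : Prop := s.head?.elim false Prod.snd = true

theorem Dec.marked (k : ℕ) (i : Var) : Dec k fun V => Marked (V i) := by
  obtain ⟨j, hij⟩ := exists_var_ne i
  refine Dec.scan (R := fun s _ => s.head?.elim false Prod.snd = true)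
    (fun (_ : Unit) a _ => .answer (a.elim false Prod.snd)) () hij fun s t => .answer ?_
  simp only [Bool.decide_eq_true]

/-! ### Comparing parts of words -/

open Classical in
/-- The relation `R` of words is recognized by a two-head automaton. -/
def TwoHead (R : List Γ' → List Γ' → Prop) : Prop :=
  ∃ (Q : Type) (_ : Finite Q) (δ : Transitions Q) (q₀ : Q),
    ∀ s t, Scan δ q₀ s t (decide (R (letters s) (letters t)))

theorem TwoHead.dec {R : List Γ' → List Γ' → Prop} (h : TwoHead R) (k : ℕ) {i j : Var}
    (hij : i ≠ j) : Dec k fun V => R (letters (V i)) (letters (V j)) := by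
  classical
  obtain ⟨Q, _, δ, q₀, h⟩ := h
  exact Dec.scan (R := fun s t => R (letters s) (letters t)) δ q₀ hij h

/-- The action with the heads exchanged. -/
def Action.swap {Q : Type} : Action Q → Action Q
  | .answer b => .answer b
  | .left q => .right q
  | .right q => .left q

theorem Scan.swap {Q : Type} {δ : Transitions Q} {q : Q} {s t : List Cell} {b : Bool}
    (h : Scan δ q s t b) : Scan (fun q a b => (δ q b a).swap) q t s b := by
  induction h with
  | answer h => exact .answer (by rw [h]; rfl)
  | left h _ ih => exact .right (by rw [h]; rfl) ih
  | right h _ ih => exact .left (by rw [h]; rfl) ih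

theorem TwoHead.swap {R : List Γ' → List Γ' → Prop} (h : TwoHead R) :
    TwoHead fun s t => R t s := by
  obtain ⟨Q, hQ, δ, q₀, h⟩ := h
  exact ⟨Q, hQ, _, q₀, fun s t => (h t s).swap⟩

/-- The action with new names for the states. -/
def Action.map {Q Q' : Type} (f : Q → Q') : Action Q → Action Q'
  | .answer b => .answer b
  | .left q => .left (f q)
  | .right q => .right (f q)

theorem Scan.map {Q Q' : Type} {f : Q → Q'} {δ : Transitions Q} {δ' : Transitions Q'}
    (hδ : ∀ q a b, δ' (f q) a b = (δ q a b).map f) {q : Q} {s t : List Cell} {b : Bool}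
    (h : Scan δ q s t b) : Scan δ' (f q) s t b := by
  induction h with
  | answer h => exact .answer (by rw [hδ, h]; rfl)
  | left h _ ih => exact .left (by rw [hδ, h]; rfl) ih
  | right h _ ih => exact .right (by rw [hδ, h]; rfl) ih

/-- Drop the letters up to the first occurrence of `c`. -/
def after (c : Γ') (s : List Γ') : List Γ' := (s.dropWhile (· ≠ c)).tail

theorem TwoHead.after_left {R : List Γ' → List Γ' → Prop} (h : TwoHead R) (c : Γ') :
    TwoHead fun s t => R (after c s) t := by
  classical
  obtain ⟨Q, hQ, δ, q₀, h⟩ := h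
  let δ' : Transitions (Option Q)
    | some q, a, b => (δ q a b).map some
    | none, none, b => (δ q₀ none b).map some
    | none, some a, _ => .left (if a.1 = c then some q₀ else none)
  have found {q s t b} (r : Scan δ q s t b) : Scan δ' (some q) s t b := r.map fun _ _ _ => rfl
  refine ⟨Option Q, inferInstance, δ', none, fun s t => ?_⟩
  induction s with
  | nil =>
    have r := found (h [] t)
    cases r with
    | answer h => exact .answer h
    | right h r => exact .right h r
  | cons a s ih =>
    by_cases ha : a.1 = c
    · exact .left (q' := some q₀) (by simp [δ', ha]) (by simpa [after, ha] using found (h s t))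
    · exact .left (q' := none) (by simp [δ', ha]) (by simpa [after, ha] using ih)

/-- Drop the letters up to the `n`-th occurrence of `c`. -/
def skip (c : Γ') (n : ℕ) : List Γ' → List Γ' := (after c)^[n]

theorem TwoHead.skip_left {R : List Γ' → List Γ' → Prop} (h : TwoHead R) (c : Γ') (n : ℕ) :
    TwoHead fun s t => R (skip c n s) t := by
  induction n with
  | zero => exact h
  | succ n ih => exact ih.after_left c

theorem skip_append {c : Γ'} {A : List Γ'} (hA : c ∉ A) (n : ℕ) (X : List Γ') :
    skip c (n + 1) (A ++ c :: X) = skip c n X := by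
  have hA' : A.dropWhile (· ≠ c) = [] := by
    rw [List.dropWhile_eq_nil_iff]
    intro x hx
    simpa using ne_of_mem_of_not_mem hx hA
  rw [skip, Function.iterate_succ_apply, after, List.dropWhile_append, hA']
  simp [skip]

/-- The two words agree up to the first delimiter. -/
def agree (D : Γ' → Bool) : List Γ' → List Γ' → Bool
  | a :: s, b :: t => if D a || D b then D a && D b else decide (a = b) && agree D s t
  | _, _ => false

theorem agree_append_iff {D : Γ' → Bool} {A B X Y : List Γ'} {c d : Γ'} (hA : ∀ a ∈ A, D a = false)
    (hB : ∀ b ∈ B, D b = false) (hc : D c = true) (hd : D d = true) :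
    agree D (A ++ c :: X) (B ++ d :: Y) = true ↔ A = B := by
  induction A generalizing B with
  | nil =>
    cases B with
    | nil => simp [agree, hc, hd]
    | cons b B => simp [agree, hc, hB b (by simp)]
  | cons a A ih =>
    cases B with
    | nil => simp [agree, hd, hA a (by simp)]
    | cons b B =>
      simp only [List.cons_append, agree, hA a (by simp), hB b (by simp), Bool.or_self,
        Bool.false_eq_true, if_false, Bool.and_eq_true, decide_eq_true_eq, List.cons.injEq]
      rw [ih (fun x hx => hA x (by simp [hx])) fun x hx => hB x (by simp [hx])]

theorem twoHead_agree (D : Γ' → Bool) : TwoHead fun s t => agree D s t = true := by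
  let δ : Transitions (Option Γ')
    | none, none, _ | some _, _, none => .answer false
    | none, some a, _ => .left (some a.1)
    | some a, _, some b =>
      if D a || D b.1 then .answer (D a && D b.1)
      else if a = b.1 then .right none else .answer false
  refine ⟨Option Γ', inferInstance, δ, none, fun s => ?_⟩
  simp only [Bool.decide_eq_true]
  induction s with
  | nil => exact fun t => .answer rfl
  | cons a s ih =>
    rintro (_ | ⟨b, t⟩)
    · exact .left rfl (.answer rfl)
    · refine .left rfl ?_
      by_cases hD : (D a.1 || D b.1) = true
      · exact .answer (by simp only [δ, List.head?_cons, List.map_cons, agree, hD, if_true])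
      · by_cases hab : a.1 = b.1
        · have hD' : D b.1 = false := by simpa [hab] using hD
          exact .right (q' := none) (by simp only [δ, if_neg hD, if_pos hab])
            (by simpa [agree, hab, hD'] using ih t)
        · exact .answer (by
            simp only [δ, List.head?_cons, List.map_cons, agree, if_neg hD, hab, if_false,
              decide_false, Bool.false_and])

theorem Dec.agree (k : ℕ) (D : Γ' → Bool) (c : Γ') (n m : ℕ) {i j : Var} (hij : i ≠ j) :
    Dec k fun V => agree D (skip c n (letters (V i))) (skip c m (letters (V j))) = true :=
  ((((twoHead_agree D).skip_left c n).swap.skip_left c m).swap).dec k hij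

section Acyclic

variable {α : Type}

theorem exists_undominated {r : α → α → Prop} (hr : ∀ p, ¬ Relation.TransGen r p p)
    {s : Finset α} (hs : s.Nonempty) : ∃ a ∈ s, ∀ y ∈ s, ¬ r y a := by
  let lt : s → s → Prop := fun a b => Relation.TransGen r a b
  have : IsTrans s lt := ⟨fun _ _ _ => Relation.TransGen.trans⟩
  have : Std.Irrefl lt := ⟨fun a => hr a⟩
  have wf : WellFounded lt := Finite.wellFounded_of_trans_of_irrefl lt
  obtain ⟨x, hx⟩ := hs
  obtain ⟨⟨a, ha⟩, -, h⟩ := WellFounded.has_min wf Set.univ ⟨⟨x, hx⟩, trivial⟩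
  exact ⟨a, ha, fun y hy hya => h ⟨y, hy⟩ trivial (.single hya)⟩

theorem acyclic_of_undominated {r r' : α → α → Prop} {T : α → Prop}
    (hr : ∀ p, ¬ Relation.TransGen r p p) (h : ∀ x y, r' x y → r x y ∨ T x)
    (hT : ∀ z x, T x → ¬ r' z x) (p : α) : ¬ Relation.TransGen r' p p := by
  intro hp
  have transGen_of_dominated :
      ∀ x y, Relation.TransGen r' x y → (∃ z, r' z x) → Relation.TransGen r x y := by
    intro x y hxy
    induction hxy using Relation.TransGen.head_induction_on with
    | single hxy =>
      rintro ⟨z, hz⟩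
      exact .single ((h _ _ hxy).resolve_right fun t => hT _ _ t hz)
    | head hxy _ ih =>
      rintro ⟨z, hz⟩
      exact .head ((h _ _ hxy).resolve_right fun t => hT _ _ t hz) (ih ⟨_, hxy⟩)
  obtain ⟨z, -, hz⟩ := Relation.TransGen.tail'_iff.1 hp
  exact hr p (transGen_of_dominated p p hp ⟨z, hz⟩)

end Acyclic

/-! ### The shape of conflicts under one dependency per relation -/

section Conflicts

variable {S : Schema} {F : Set (FD S)} {I J : DBInstance S} {r : Fact S → Fact S → Prop}
  {p q o : Fact S}

/-- The list of the constants of a fact, each written as a string. -/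
def segments (p : Fact S) : List (List Computability.Γ') :=
  List.ofFn fun i => encodeConst (S.dom p.1 i) (p.2 i)

/-- The facts `p` and `q` of the relation `R` have the same constants at the positions in `X`.
Constants are compared as strings, so that tuples of different types need not be transported. -/
def AgreeOn (R : Fin S.numRel) (X : Finset (Fin (S.arity R))) (p q : Fact S) : Prop :=
  p.1 = R ∧ q.1 = R ∧ ∀ i ∈ X, (segments p)[i.val]? = (segments q)[i.val]?

section AgreeOn

variable {R : Fin S.numRel} {X : Finset (Fin (S.arity R))}

theorem agreeOn_mk {t u : Tuple S R} : AgreeOn R X ⟨R, t⟩ ⟨R, u⟩ ↔ ∀ i ∈ X, t i = u i := by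
  simp only [AgreeOn, true_and]
  refine forall₂_congr fun i _ => ?_
  have getElem_segments (v : Tuple S R) :
      (segments ⟨R, v⟩)[i.val]? = some (encodeConst (S.dom R i) (v i)) := by
    simp [segments]
  rw [getElem_segments, getElem_segments, Option.some_inj, (encodeConst_inj _).eq_iff]

theorem AgreeOn.symm (h : AgreeOn R X p q) : AgreeOn R X q p :=
  ⟨h.2.1, h.1, fun i hi => (h.2.2 i hi).symm⟩

theorem AgreeOn.trans (h : AgreeOn R X p q) (h' : AgreeOn R X q o) : AgreeOn R X p o :=
  ⟨h.1, h'.2.1, fun i hi => (h.2.2 i hi).trans (h'.2.2 i hi)⟩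

end AgreeOn

theorem FD.violates_iff {f : FD S} :
    f.Violates p q ↔ AgreeOn f.rel f.lhs p q ∧ ¬ AgreeOn f.rel f.rhs p q := by
  constructor
  · rintro ⟨t, u, rfl, rfl, h, h'⟩
    exact ⟨agreeOn_mk.2 h, fun h'' => h' (agreeOn_mk.1 h'')⟩
  · obtain ⟨R, t⟩ := p
    obtain ⟨R', u⟩ := q
    rintro ⟨h, h'⟩
    obtain rfl : R = f.rel := h.1
    obtain rfl : R' = f.rel := h.2.1
    exact ⟨t, u, rfl, rfl, agreeOn_mk.1 h, fun h'' => h' (agreeOn_mk.2 h'')⟩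

/-- `p` and `q` violate a dependency. -/
def Clash (F : Set (FD S)) (p q : Fact S) : Prop := ∃ f ∈ F, f.Violates p q

/-- `p` and `q` agree on the left-hand side of a dependency, or are equal. When there is at most one
dependency per relation, this is an equivalence relation, whose classes are called groups. -/
def SameGroup (F : Set (FD S)) (p q : Fact S) : Prop :=
  p = q ∨ ∃ f ∈ F, AgreeOn f.rel f.lhs p q

/-- `p` and `q` agree on both sides of a dependency, or are equal. When there is at most one
dependency per relation, this equivalence relation divides every group into parts. -/
def SamePart (F : Set (FD S)) (p q : Fact S) : Prop :=
  p = q ∨ ∃ f ∈ F, AgreeOn f.rel f.lhs p q ∧ AgreeOn f.rel f.rhs p q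

theorem SamePart.sameGroup (h : SamePart F p q) : SameGroup F p q :=
  h.imp_right fun ⟨f, hf, h, _⟩ => ⟨f, hf, h⟩

theorem SameGroup.refl (p : Fact S) : SameGroup F p p := .inl rfl

theorem SamePart.refl (p : Fact S) : SamePart F p p := .inl rfl

theorem SameGroup.symm (h : SameGroup F p q) : SameGroup F q p :=
  h.imp Eq.symm fun ⟨f, hf, h⟩ => ⟨f, hf, h.symm⟩

theorem SamePart.symm (h : SamePart F p q) : SamePart F q p :=
  h.imp Eq.symm fun ⟨f, hf, h, h'⟩ => ⟨f, hf, h.symm, h'.symm⟩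

variable (hF : F.InjOn FD.rel)
include hF

theorem SameGroup.trans (h : SameGroup F p q) (h' : SameGroup F q o) : SameGroup F p o := by
  rcases h with rfl | ⟨f, hf, h⟩
  · exact h'
  · rcases h' with rfl | ⟨g, hg, h'⟩
    · exact .inr ⟨f, hf, h⟩
    · obtain rfl := hF hf hg (h.2.1.symm.trans h'.1)
      exact .inr ⟨f, hf, h.trans h'⟩

theorem SamePart.trans (h : SamePart F p q) (h' : SamePart F q o) : SamePart F p o := by
  rcases h with rfl | ⟨f, hf, h⟩
  · exact h'
  · rcases h' with rfl | ⟨g, hg, h'⟩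
    · exact .inr ⟨f, hf, h⟩
    · obtain rfl := hF hf hg (h.1.2.1.symm.trans h'.1.1)
      exact .inr ⟨f, hf, h.1.trans h'.1, h.2.trans h'.2⟩

theorem clash_iff : Clash F p q ↔ SameGroup F p q ∧ ¬ SamePart F p q := by
  constructor
  · rintro ⟨f, hf, h⟩
    rw [FD.violates_iff] at h
    refine ⟨.inr ⟨f, hf, h.1⟩, ?_⟩
    rintro (rfl | ⟨g, hg, h'⟩)
    · exact h.2 ⟨h.1.1, h.1.1, fun _ _ => rfl⟩
    · obtain rfl := hF hf hg (h.1.1.symm.trans h'.1.1)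
      exact h.2 h'.2
  · rintro ⟨rfl | ⟨f, hf, h⟩, h'⟩
    · exact absurd (.refl p) h'
    · exact ⟨f, hf, FD.violates_iff.2 ⟨h, fun h'' => h' (.inr ⟨f, hf, h, h''⟩)⟩⟩

theorem Clash.symm (h : Clash F p q) : Clash F q p := by
  rw [clash_iff hF] at h ⊢
  exact ⟨h.1.symm, fun h' => h.2 h'.symm⟩

theorem Clash.congr_right (h : Clash F o p) (hpq : SamePart F p q) : Clash F o q := by
  rw [clash_iff hF] at h ⊢
  exact ⟨h.1.trans hF hpq.sameGroup, fun h' => h.2 (h'.trans hF hpq.symm)⟩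

theorem consistent_iff :
    Consistent F J ↔ ∀ p ∈ J, ∀ q ∈ J, SameGroup F p q → SamePart F p q := by
  constructor
  · intro h p hp q hq hg
    by_contra hs
    obtain ⟨f, hf, hv⟩ := (clash_iff hF).2 ⟨hg, hs⟩
    exact h f hf p hp q hq hv
  · intro h f hf p hp q hq hv
    have hpq := (clash_iff hF).1 ⟨f, hf, hv⟩
    exact hpq.2 (h p hp q hq hpq.1)

/-! ### Repairs choose a part of every group -/

theorem Consistent.insert [DecidableEq (Fact S)] (hJ : Consistent F J)
    (hp : ∀ q ∈ J, SameGroup F p q → SamePart F p q) : Consistent F (insert p J) := by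
  rw [consistent_iff hF] at hJ ⊢
  intro a ha b hb hg
  rcases Finset.mem_insert.1 ha with rfl | ha' <;> rcases Finset.mem_insert.1 hb with rfl | hb'
  · exact .refl _
  · exact hp b hb' hg
  · exact (hp a ha' hg.symm).symm
  · exact hJ a ha' b hb' hg

theorem IsRepair.mem_of_forall_samePart (h : IsRepair F I J) (hp : p ∈ I)
    (hpJ : ∀ q ∈ J, SameGroup F p q → SamePart F p q) : p ∈ J := by
  classical
  rw [← h.2.2 (insert p J) (Finset.subset_insert _ _) (Finset.insert_subset hp h.1)
    (h.2.1.insert hF hpJ)]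
  exact Finset.mem_insert_self _ _

theorem IsRepair.mem_of_samePart (h : IsRepair F I J) (hp : p ∈ J) (hq : q ∈ I)
    (hpq : SamePart F p q) : q ∈ J :=
  h.mem_of_forall_samePart hF hq fun b hb hg =>
    hpq.symm.trans hF ((consistent_iff hF).1 h.2.1 p hp b hb (hpq.sameGroup.trans hF hg))

theorem IsRepair.exists_sameGroup (h : IsRepair F I J) (hp : p ∈ I) :
    ∃ q ∈ J, SameGroup F p q := by
  by_contra! hn
  exact hn p (h.mem_of_forall_samePart hF hp fun q hq hg => absurd hg (hn q hq)) (.refl p)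

open Classical in
theorem isRepair_filter_samePart {c : Fact S → Fact S} (hcI : ∀ x ∈ I, c x ∈ I)
    (hcx : ∀ x ∈ I, SameGroup F x (c x)) (hc : ∀ x y, SameGroup F x y → c x = c y) :
    IsRepair F I (I.filter fun x => SamePart F x (c x)) := by
  refine ⟨Finset.filter_subset _ _, (consistent_iff hF).2 ?_, fun K hJK hKI hK => ?_⟩
  · intro p hp q hq hg
    have hpc := (Finset.mem_filter.1 hp).2
    rw [hc p q hg] at hpc
    exact hpc.trans hF (Finset.mem_filter.1 hq).2.symm
  · refine Finset.Subset.antisymm (fun x hx => Finset.mem_filter.2 ⟨hKI hx, ?_⟩) hJK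
    have hxc := hcx x (hKI hx)
    refine (consistent_iff hF).1 hK x hx (c x) (hJK (Finset.mem_filter.2 ⟨hcI x (hKI hx), ?_⟩)) hxc
    rw [← hc x _ hxc]
    exact .refl _

/-! ### Optimality is decided part by part -/

omit hF

/-- No fact dominates the whole part of `p`: the local form of Pareto optimality. -/
def ParetoGood (F : Set (FD S)) (I : DBInstance S) (r : Fact S → Fact S → Prop) (p : Fact S) :
    Prop :=
  ¬ ∃ y ∈ I, Clash F y p ∧ ∀ x ∈ I, SamePart F x p → r y x

/-- No other part dominates the part of `p`: the local form of global optimality. -/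
def GlobalGood (F : Set (FD S)) (I : DBInstance S) (r : Fact S → Fact S → Prop) (p : Fact S) :
    Prop :=
  ¬ ∃ z ∈ I, Clash F z p ∧ ∀ x ∈ I, SamePart F x p → ∃ y ∈ I, SamePart F y z ∧ r y x

/-- The part of `p` contains an undominated fact: the local form of common optimality. -/
def CommonGood (F : Set (FD S)) (I : DBInstance S) (r : Fact S → Fact S → Prop) (p : Fact S) :
    Prop :=
  ∃ a ∈ I, SamePart F a p ∧ ∀ y ∈ I, ¬ r y a

theorem CommonGood.globalGood (h : CommonGood F I r p) : GlobalGood F I r p := by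
  obtain ⟨a, ha, hap, hr⟩ := h
  rintro ⟨z, -, -, hx⟩
  obtain ⟨y, hy, -, hya⟩ := hx a ha hap
  exact hr y hy hya

theorem GlobalGood.paretoGood (h : GlobalGood F I r p) : ParetoGood F I r p :=
  fun ⟨y, hy, hyp, hx⟩ => h ⟨y, hy, hyp, fun x hxI hxp => ⟨y, hy, .refl y, hx x hxI hxp⟩⟩

include hF

theorem CommonGood.congr (hpq : SamePart F p q) (h : CommonGood F I r p) : CommonGood F I r q :=
  let ⟨a, ha, hap, hr⟩ := h
  ⟨a, ha, hap.trans hF hpq, hr⟩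

theorem GlobalGood.congr (hpq : SamePart F p q) (h : GlobalGood F I r p) : GlobalGood F I r q :=
  fun ⟨z, hz, hzq, hx⟩ => h ⟨z, hz, hzq.congr_right hF hpq.symm,
    fun x hxI hxp => hx x hxI (hxp.trans hF hpq)⟩

theorem ParetoGood.congr (hpq : SamePart F p q) (h : ParetoGood F I r p) : ParetoGood F I r q :=
  fun ⟨z, hz, hzq, hx⟩ => h ⟨z, hz, hzq.congr_right hF hpq.symm,
    fun x hxI hxp => hx x hxI (hxp.trans hF hpq)⟩

theorem isPriority_iff :
    IsPriority F I r ↔ (∀ p, ¬ Relation.TransGen r p p) ∧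
      ∀ p q, r p q → p ∈ I ∧ q ∈ I ∧ Clash F p q := by
  classical
  constructor
  · rintro ⟨h1, h2, h3⟩
    refine ⟨h2, fun p q hpq => ⟨(h1 p q hpq).1, (h1 p q hpq).2, ?_⟩⟩
    obtain ⟨C, ⟨-, f, hf, a, b, rfl, hv⟩, hp, hq⟩ := h3 p q hpq
    have hne : p ≠ q := by
      rintro rfl
      exact h2 p (.single hpq)
    have hab : Clash F a b := ⟨f, hf, hv⟩
    simp only [Finset.mem_insert, Finset.mem_singleton] at hp hq
    rcases hp with rfl | rfl <;> rcases hq with rfl | rfl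
    · exact absurd rfl hne
    · exact hab
    · exact hab.symm hF
    · exact absurd rfl hne
  · rintro ⟨h1, h2⟩
    refine ⟨fun p q h => ⟨(h2 p q h).1, (h2 p q h).2.1⟩, h1, fun p q h => ?_⟩
    obtain ⟨hp, hq, f, hf, hv⟩ := h2 p q h
    exact ⟨{p, q}, ⟨Finset.insert_subset hp (Finset.singleton_subset_iff.2 hq), f, hf, p, q, rfl,
      hv⟩, by simp, by simp⟩

theorem IsPriority.clash (hr : IsPriority F I r) (h : r p q) : Clash F p q :=
  (((isPriority_iff hF).1 hr).2 p q h).2.2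

theorem IsPriority.exists_undominated (hr : IsPriority F I r) (hp : p ∈ I) :
    ∃ q ∈ I, SameGroup F q p ∧ ∀ y ∈ I, ¬ r y q := by
  classical
  obtain ⟨a, ha, h⟩ := CQA.exists_undominated hr.2.1 (s := I.filter fun q => SameGroup F q p)
    ⟨p, by simp [hp, SameGroup.refl]⟩
  rw [Finset.mem_filter] at ha
  refine ⟨a, ha.1, ha.2, fun y hy hya => h y (Finset.mem_filter.2 ⟨hy, ?_⟩) hya⟩
  exact ((clash_iff hF).1 (hr.clash hF hya)).1.trans hF ha.2

open Classical in
theorem Consistent.replace_group {Y : DBInstance S} (hJ : Consistent F J)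
    (hYp : ∀ y ∈ Y, SameGroup F y p) (hY : ∀ y ∈ Y, ∀ z ∈ Y, SamePart F y z) :
    Consistent F ((J \ J.filter fun x => SameGroup F x p) ∪ Y) := by
  have not_sameGroup : ∀ a ∈ J \ J.filter (fun x => SameGroup F x p), ∀ y ∈ Y,
      ¬ SameGroup F a y := by
    intro a ha y hy hg
    rw [Finset.mem_sdiff, Finset.mem_filter] at ha
    exact ha.2 ⟨ha.1, hg.trans hF (hYp y hy)⟩
  rw [consistent_iff hF] at hJ ⊢
  intro a ha b hb hg
  rcases Finset.mem_union.1 ha with ha | ha <;> rcases Finset.mem_union.1 hb with hb | hb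
  · exact hJ a (Finset.mem_sdiff.1 ha).1 b (Finset.mem_sdiff.1 hb).1 hg
  · exact absurd hg (not_sameGroup a ha b hb)
  · exact absurd hg.symm (not_sameGroup b hb a ha)
  · exact hY a ha b hb

theorem IsRepair.mem_exchanged {X Y : DBInstance S} [DecidableEq (Fact S)] (hJ : IsRepair F I J)
    (hXY : Consistent F ((J \ X) ∪ Y)) (hp : p ∈ J) (hq : q ∈ Y) (hqp : Clash F q p) (ho : o ∈ I)
    (hop : SamePart F o p) : o ∈ X := by
  by_contra hn
  have hoJ := hJ.mem_of_samePart hF hp ho hop.symm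
  rw [clash_iff hF] at hqp
  have hqo := (consistent_iff hF).1 hXY q (Finset.mem_union_right _ hq) o
    (Finset.mem_union_left _ (Finset.mem_sdiff.2 ⟨hoJ, hn⟩)) (hqp.1.trans hF hop.symm.sameGroup)
  exact hqp.2 (hqo.trans hF hop)

theorem paretoOptimal_iff (hr : IsPriority F I r) (hJ : IsRepair F I J) :
    ParetoOptimal F I r J ↔ ∀ p ∈ J, ParetoGood F I r p := by
  classical
  have hc := (consistent_iff hF).1 hJ.2.1
  constructor
  · rintro ⟨-, h⟩ p hp ⟨y, hy, hyp, hdom⟩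
    rw [clash_iff hF] at hyp
    refine h ⟨J.filter fun x => SameGroup F x p, {y}, ⟨p, by simp [hp, SameGroup.refl]⟩,
      Finset.filter_subset _ _, by simp, ?_, ?_, hJ.2.1.replace_group hF ?_ ?_⟩
    · rw [Finset.singleton_subset_iff, Finset.mem_sdiff]
      exact ⟨hy, fun hyJ => hyp.2 (hc y hyJ p hp hyp.1)⟩
    · intro x hx y' hy'
      rw [Finset.mem_singleton.1 hy']
      rw [Finset.mem_filter] at hx
      exact hdom x (hJ.1 hx.1) (hc x hx.1 p hp hx.2)
    · simpa using hyp.1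
    · simpa using SamePart.refl y
  · refine fun h => ⟨hJ.1, ?_⟩
    rintro ⟨X, Y, ⟨x, hx⟩, hXJ, ⟨y, hy⟩, hY, hdom, hcons⟩
    have hyx := hr.clash hF (hdom x hx y hy)
    exact h x (hXJ hx) ⟨y, (Finset.mem_sdiff.1 (hY hy)).1, hyx, fun x' hx' hs =>
      hdom x' (hJ.mem_exchanged hF hcons (hXJ hx) hy hyx hx' hs) y hy⟩

theorem globallyOptimal_iff (hr : IsPriority F I r) (hJ : IsRepair F I J) :
    GloballyOptimal F I r J ↔ ∀ p ∈ J, GlobalGood F I r p := by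
  classical
  have hc := (consistent_iff hF).1 hJ.2.1
  constructor
  · rintro ⟨-, h⟩ p hp ⟨z, -, hzp, hdom⟩
    rw [clash_iff hF] at hzp
    refine h ⟨J.filter fun x => SameGroup F x p, I.filter fun y => SamePart F y z,
      ⟨p, by simp [hp, SameGroup.refl]⟩, Finset.filter_subset _ _, ?_, ?_,
      hJ.2.1.replace_group hF (fun y hy => ?_) fun y hy y' hy' => ?_⟩
    · intro y hy
      rw [Finset.mem_filter] at hy
      refine Finset.mem_sdiff.2 ⟨hy.1, fun hyJ => hzp.2 (hy.2.symm.trans hF ?_)⟩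
      exact hc y hyJ p hp (hy.2.sameGroup.trans hF hzp.1)
    · intro x hx
      rw [Finset.mem_filter] at hx
      obtain ⟨y, hy, hyz, hyx⟩ := hdom x (hJ.1 hx.1) (hc x hx.1 p hp hx.2)
      exact ⟨y, Finset.mem_filter.2 ⟨hy, hyz⟩, hyx⟩
    · exact (Finset.mem_filter.1 hy).2.sameGroup.trans hF hzp.1
    · exact (Finset.mem_filter.1 hy).2.trans hF (Finset.mem_filter.1 hy').2.symm
  · refine fun h => ⟨hJ.1, ?_⟩
    rintro ⟨X, Y, ⟨x, hx⟩, hXJ, hY, hdom, hcons⟩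
    obtain ⟨y, hy, hyx⟩ := hdom x hx
    replace hyx := hr.clash hF hyx
    refine h x (hXJ hx) ⟨y, (Finset.mem_sdiff.1 (hY hy)).1, hyx, fun x' hx' hs => ?_⟩
    obtain ⟨y', hy', hyx'⟩ := hdom x' (hJ.mem_exchanged hF hcons (hXJ hx) hy hyx hx' hs)
    refine ⟨y', (Finset.mem_sdiff.1 (hY hy')).1, ?_, hyx'⟩
    refine (consistent_iff hF).1 hcons y' (Finset.mem_union_right _ hy') y
      (Finset.mem_union_right _ hy) ?_
    exact (((clash_iff hF).1 (hr.clash hF hyx')).1.trans hF hs.sameGroup).trans hF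
      ((clash_iff hF).1 hyx).1.symm

omit hF in
theorem IsPriority.exists_isTotalPriority (hr : IsPriority F I r) :
    ∃ r', IsTotalPriority F I r' ∧ ∀ p q, r p q → r' p q := by
  classical
  let rel (P : Finset (Fact S × Fact S)) : Fact S → Fact S → Prop := fun p q => (p, q) ∈ P
  let graph (r : Fact S → Fact S → Prop) := (I ×ˢ I).filter fun e => r e.1 e.2
  have rel_graph : ∀ r, IsPriority F I r → rel (graph r) = r := by
    intro r hr
    funext p q
    have := hr.1 p q
    simp only [rel, graph, Finset.mem_filter, Finset.mem_product, eq_iff_iff]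
    tauto
  have mem_candidates : ∀ r', IsPriority F I r' → (∀ p q, r p q → r' p q) → graph r' ∈
      (I ×ˢ I).powerset.filter fun P => IsPriority F I (rel P) ∧ ∀ p q, r p q → rel P p q := by
    intro r' hr' h
    rw [Finset.mem_filter, rel_graph r' hr', Finset.mem_powerset]
    exact ⟨Finset.filter_subset _ _, hr', h⟩
  obtain ⟨P, hP, hmax⟩ := Finset.exists_max_image _ Finset.card
    ⟨_, mem_candidates r hr fun _ _ h => h⟩
  rw [Finset.mem_filter] at hP
  refine ⟨rel P, ⟨hP.2.1, fun r' hr' hsub => ?_⟩, hP.2.2⟩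
  have hle := hmax _ (mem_candidates r' hr' fun p q h => hsub p q (hP.2.2 p q h))
  rw [Finset.eq_of_subset_of_card_le (s := P) (t := graph r') ?_ hle, rel_graph r' hr']
  rintro ⟨p, q⟩ he
  exact Finset.mem_filter.2 ⟨Finset.mem_powerset.1 hP.1 he, hsub p q he⟩

theorem IsPriority.sup_undominated (hr : IsPriority F I r) {T : Fact S → Prop}
    (hT : ∀ x, T x → x ∈ I ∧ ∀ y ∈ I, ¬ r y x) (hTT : ∀ x y, T x → T y → ¬ Clash F x y) :
    IsPriority F I fun p q => r p q ∨ T p ∧ q ∈ I ∧ Clash F p q := by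
  refine (isPriority_iff hF).2
    ⟨acyclic_of_undominated hr.2.1 (fun p q h => h.imp_right And.left) ?_, ?_⟩
  · rintro z x hx (h | ⟨hz, -, hzx⟩)
    · exact (hT x hx).2 z (hr.1 z x h).1 h
    · exact hTT z x hz hx hzx
  · rintro p q (h | ⟨hp, hq, hpq⟩)
    · exact ((isPriority_iff hF).1 hr).2 p q h
    · exact ⟨(hT p hp).1, hq, hpq⟩

theorem IsTotalPriority.of_undominated (hr : IsTotalPriority F I r) (hp : p ∈ I) (hq : q ∈ I)
    (hpq : Clash F p q) (hu : ∀ y ∈ I, ¬ r y p) : r p q := by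
  have hr' : IsPriority F I fun x y => r x y ∨ x = p ∧ y ∈ I ∧ Clash F x y := by
    refine hr.1.sup_undominated hF (fun x hx => hx ▸ ⟨hp, hu⟩) ?_
    rintro x y rfl rfl h
    exact ((clash_iff hF).1 h).2 (.refl _)
  rw [← hr.2 _ hr' fun _ _ => .inl]
  exact .inr ⟨rfl, hq, hpq⟩

theorem IsTotalPriority.commonGood (hr : IsTotalPriority F I r) (hp : p ∈ I)
    (h : GlobalGood F I r p) : CommonGood F I r p := by
  obtain ⟨a, ha, hap, hu⟩ := hr.1.exists_undominated hF hp
  refine ⟨a, ha, ?_, hu⟩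
  by_contra hn
  have hcl := (clash_iff hF).2 ⟨hap, hn⟩
  exact h ⟨a, ha, hcl, fun x hx hxp =>
    ⟨a, ha, .refl a, hr.of_undominated hF ha hx (hcl.congr_right hF hxp.symm) hu⟩⟩

theorem commonOptimal_iff (hr : IsPriority F I r) (hJ : IsRepair F I J) :
    CommonOptimal F I r J ↔ ∀ p ∈ J, CommonGood F I r p := by
  have hc := (consistent_iff hF).1 hJ.2.1
  constructor
  · rintro ⟨-, r', ht, hsub, hg⟩ p hp
    obtain ⟨a, ha, hap, hu⟩ := ht.commonGood hF (hJ.1 hp)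
      ((globallyOptimal_iff hF ht.1 hJ).1 hg p hp)
    exact ⟨a, ha, hap, fun y hy h => hu y hy (hsub _ _ h)⟩
  · intro h
    -- Let the undominated facts of `J` dominate everything they clash with, and extend the result.
    obtain ⟨r', ht, hsub⟩ := (hr.sup_undominated hF (T := fun x => x ∈ J ∧ ∀ y ∈ I, ¬ r y x)
      (fun x hx => ⟨hJ.1 hx.1, hx.2⟩) fun x y hx hy hxy =>
        ((clash_iff hF).1 hxy).2 (hc x hx.1 y hy.1 ((clash_iff hF).1 hxy).1)).exists_isTotalPriority
    refine ⟨hJ.1, r', ht, fun p q h => hsub p q (.inl h), (globallyOptimal_iff hF ht.1 hJ).2 ?_⟩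
    rintro p hp
    obtain ⟨a, ha, hap, hu⟩ := h p hp
    refine CommonGood.globalGood ⟨a, ha, hap, fun y hy hya => ?_⟩
    have hay : r' a y := hsub a y (.inr
      ⟨⟨hJ.mem_of_samePart hF hp ha hap.symm, hu⟩, hy, (ht.1.clash hF hya).symm hF⟩)
    exact ht.1.2.1 a (.tail (.single hay) hya)

/-! ### Preferred answers -/

omit hF

/-- The facts that occur in a query. -/
def Query.facts : Query S → Finset (Fact S)
  | .fact p => {p}
  | .neg φ => φ.facts
  | .conj φ ψ | .disj φ ψ => φ.facts ∪ ψ.facts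
  | _ => ∅

theorem Query.holds_congr {J K : DBInstance S} : ∀ {Q : Query S}, (∀ q ∈ Q.facts, q ∈ J ↔ q ∈ K) →
    (Q.Holds J ↔ Q.Holds K)
  | .fact p, h => h p (by simp [Query.facts])
  | .nameEq _ _, _ | .nameNe _ _, _ | .comp _ _ _, _ => Iff.rfl
  | .neg φ, h => not_congr (Query.holds_congr (Q := φ) h)
  | .conj φ ψ, h => and_congr
      (Query.holds_congr (Q := φ) fun q hq => h q (Finset.mem_union_left _ hq))
      (Query.holds_congr (Q := ψ) fun q hq => h q (Finset.mem_union_right _ hq))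
  | .disj φ ψ, h => or_congr
      (Query.holds_congr (Q := φ) fun q hq => h q (Finset.mem_union_left _ hq))
      (Query.holds_congr (Q := ψ) fun q hq => h q (Finset.mem_union_right _ hq))

variable {good : Fact S → Prop} {D T : Finset (Fact S)}

/-- Choosing the part of `p` in the group of `q` is allowed by `good`, and keeps exactly the facts
of `T` among the facts of that group that belong to `D`. -/
def Selects (F : Set (FD S)) (I : DBInstance S) (good : Fact S → Prop) (D T : Finset (Fact S))
    (q p : Fact S) : Prop :=
  p ∈ I ∧ good p ∧ SameGroup F p q ∧
    ∀ q' ∈ D, SameGroup F q q' → (q' ∈ T ↔ q' ∈ I ∧ SamePart F q' p)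

include hF

theorem Selects.congr (hpq : SameGroup F p q) (h : Selects F I good D T p o) :
    Selects F I good D T q o :=
  ⟨h.1, h.2.1, h.2.2.1.trans hF hpq, fun q' hq' hg => h.2.2.2 q' hq' (hpq.trans hF hg)⟩

omit hF in
theorem exists_choice_of_sameGroup {P : Fact S → Fact S → Prop} (hP : ∀ x ∈ I, ∃ p, P x p)
    (hcongr : ∀ x y p, SameGroup F x y → P x p → P y p) :
    ∃ c : Fact S → Fact S, (∀ x ∈ I, P x (c x)) ∧ ∀ x y, SameGroup F x y → c x = c y := by
  refine ⟨fun x => @Classical.epsilon _ ⟨x⟩ (P x),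
    fun x hx => Classical.epsilon_spec (hP x hx), fun x y hxy => ?_⟩
  have hPxy : P x = P y :=
    funext fun p => propext ⟨hcongr x y p hxy, hcongr y x p hxy.symm⟩
  simp only [hPxy]

theorem exists_repair_of_selects (hcongr : ∀ p q, SamePart F p q → good p → good q)
    (hex : ∀ p ∈ I, ∃ q ∈ I, SameGroup F q p ∧ good q) (hT : T ⊆ I)
    (h : ∀ q ∈ D, q ∈ I → ∃ p, Selects F I good D T q p) :
    ∃ J, IsRepair F I J ∧ (∀ p ∈ J, good p) ∧ ∀ q ∈ D, q ∈ J ↔ q ∈ T := by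
  classical
  have exists_selects : ∀ x ∈ I, ∃ p, Selects F I good D T x p := by
    intro x hx
    by_cases hxq : ∃ q ∈ D, q ∈ I ∧ SameGroup F x q
    · obtain ⟨q, hqD, hqI, hxq⟩ := hxq
      obtain ⟨p, hp⟩ := h q hqD hqI
      exact ⟨p, hp.congr hF hxq.symm⟩
    · obtain ⟨p, hp, hpx, hpg⟩ := hex x hx
      refine ⟨p, hp, hpg, hpx, fun q' hq' hxq' => ⟨fun hq'T => ?_, fun hq'I => ?_⟩⟩
      · exact absurd ⟨q', hq', hT hq'T, hxq'⟩ hxq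
      · exact absurd ⟨q', hq', hq'I.1, hxq'⟩ hxq
  obtain ⟨c, hc, hcg⟩ := exists_choice_of_sameGroup exists_selects
    fun x y p hxy hp => hp.congr hF hxy
  refine ⟨I.filter fun x => SamePart F x (c x), isRepair_filter_samePart hF
    (fun x hx => (hc x hx).1) (fun x hx => (hc x hx).2.2.1.symm) hcg, fun p hp => ?_,
    fun q hq => ?_⟩
  · obtain ⟨hpI, hpc⟩ := Finset.mem_filter.1 hp
    exact hcongr _ _ hpc.symm (hc p hpI).2.1
  · rw [Finset.mem_filter]
    exact ⟨fun hqJ => ((hc q hqJ.1).2.2.2 q hq (.refl q)).2 hqJ,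
      fun hqT => ((hc q (hT hqT)).2.2.2 q hq (.refl q)).1 hqT⟩

theorem IsRepair.exists_selects [DecidableEq (Fact S)] (hJ : IsRepair F I J)
    (hgood : ∀ p ∈ J, good p) (hq : q ∈ I) :
    ∃ p, Selects F I good D (D.filter (· ∈ J)) q p := by
  obtain ⟨p, hp, hqp⟩ := hJ.exists_sameGroup hF hq
  refine ⟨p, hJ.1 hp, hgood p hp, hqp.symm, fun q' hq' hqq' => ?_⟩
  rw [Finset.mem_filter]
  constructor
  · rintro ⟨-, hqJ⟩
    exact ⟨hJ.1 hqJ, (consistent_iff hF).1 hJ.2.1 q' hqJ p hp (hqq'.symm.trans hF hqp)⟩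
  · rintro ⟨hqI, hs⟩
    exact ⟨hq', hJ.mem_of_samePart hF hp hqI hs.symm⟩

theorem preferredAnswer_iff {X : RepairFamily S}
    (hX : ∀ J, J ∈ X F I r ↔ IsRepair F I J ∧ ∀ p ∈ J, good p)
    (hcongr : ∀ p q, SamePart F p q → good p → good q)
    (hex : ∀ p ∈ I, ∃ q ∈ I, SameGroup F q p ∧ good q) (Q : Query S) (b : Bool) :
    PreferredAnswer X F I r Q b ↔ ∀ T ∈ Q.facts.powerset, ¬ (Q.Holds T ↔ b = true) →
      ¬ (T ⊆ I ∧ ∀ q ∈ Q.facts, q ∈ I → ∃ p, Selects F I good Q.facts T q p) := by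
  classical
  constructor
  · rintro h T - hT ⟨hTI, hq⟩
    obtain ⟨J, hJ, hgood, hJT⟩ := exists_repair_of_selects hF hcongr hex hTI hq
    exact hT ((Query.holds_congr fun q hq => (hJT q hq).symm).trans (h J ((hX J).2 ⟨hJ, hgood⟩)))
  · intro h J hJ
    by_contra hn
    obtain ⟨hrep, hgood⟩ := (hX J).1 hJ
    refine h (Q.facts.filter (· ∈ J)) (Finset.mem_powerset.2 (Finset.filter_subset _ _)) ?_
      ⟨fun q hq => hrep.1 (Finset.mem_filter.1 hq).2, fun q _ hqI =>
        hrep.exists_selects hF hgood hqI⟩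
    rwa [Query.holds_congr (K := J) (by simp +contextual)]

end Conflicts

/-! ### Acyclicity by rounds of marking -/

section Settled

variable {α : Type}

/-- After `n` rounds, in each of which the arrows are marked that only follow marked arrows, the
arrow `e` is marked. -/
def Settled (L : List (α × α)) : ℕ → α × α → Prop
  | 0, _ => False
  | n + 1, e => ∀ e' ∈ L, e'.2 = e.1 → Settled L n e'

theorem settled_of_acyclic {L : List (α × α)}
    (hL : ∀ p, ¬ Relation.TransGen (fun p q => (p, q) ∈ L) p p) {n : ℕ} {e : α × α}
    {s : Finset (α × α)}
    (hs : ∀ d ∈ L, Relation.ReflTransGen (fun p q => (p, q) ∈ L) d.2 e.1 → d ∈ s)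
    (hn : s.card < n) : Settled L n e := by
  classical
  induction n generalizing e s with
  | zero => simp at hn
  | succ n ih =>
    intro d hd hde
    have hds : d ∈ s := hs d hd (hde ▸ .refl)
    refine ih (s := s.erase d) (fun d' hd' h => Finset.mem_erase.2 ⟨?_, hs d' hd' ?_⟩) ?_
    · rintro rfl
      exact hL d'.1 (.head' hd' h)
    · exact hde ▸ h.tail hd
    · exact lt_of_lt_of_le (Finset.card_erase_lt_of_mem hds) (Nat.lt_succ_iff.1 hn)

theorem not_settled_of_cycle {L : List (α × α)} {e : α × α} (he : e ∈ L)
    (hcycle : Relation.ReflTransGen (fun p q => (p, q) ∈ L) e.2 e.1) (n : ℕ) :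
    ¬ Settled L n e := by
  induction n generalizing e with
  | zero => exact id
  | succ n ih =>
    intro hs
    obtain ⟨z, hz, hze⟩ := Relation.TransGen.tail'_iff.1 (Relation.TransGen.head' he hcycle)
    exact ih hze hz (hs (z, e.1) hze rfl)

theorem acyclic_iff_settled (L : List (α × α)) {n : ℕ} (hn : L.length < n) :
    (∀ p, ¬ Relation.TransGen (fun p q => (p, q) ∈ L) p p) ↔ ∀ e ∈ L, Settled L n e := by
  classical
  refine ⟨fun hL e _ => settled_of_acyclic hL (s := L.toFinset)
    (fun d hd _ => List.mem_toFinset.2 hd) ((List.toFinset_card_le L).trans_lt hn), ?_⟩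
  intro h p hp
  obtain ⟨z, hpz, hzp⟩ := Relation.TransGen.head'_iff.1 hp
  exact not_settled_of_cycle hpz hzp n (h _ hpz)

end Settled

/-! ### Reading encoded inputs -/

section Encoding

variable {S : Schema}

/-- The encoding of a fact without its brackets. -/
def encodeBody (p : Fact S) : List Γ' :=
  (encodeNat p.1.val).map Γ'.bit ++ ((segments p).map (Γ'.comma :: ·)).flatten

theorem encodeFact_eq (p : Fact S) : encodeFact p = Γ'.bra :: (encodeBody p ++ [Γ'.ket]) := by
  simp [encodeFact, encodeBody, segments]

theorem mem_encodeConst {k : DomainKind} {v : Const k} {c : Γ'} (hc : c ∈ encodeConst k v) :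
    c ≠ .bra ∧ c ≠ .ket ∧ c ≠ .comma := by
  cases k
  · simp only [encodeConst, List.mem_append, List.mem_cons, List.mem_map] at hc
    rcases hc with (rfl | ⟨b, -, rfl⟩) | rfl | ⟨b, -, rfl⟩ <;> simp
  · simp only [encodeConst, List.mem_map] at hc
    obtain ⟨b, -, rfl⟩ := hc
    simp

theorem mem_segments {p : Fact S} {l : List Γ'} (hl : l ∈ segments p) {c : Γ'} (hc : c ∈ l) :
    c ≠ .bra ∧ c ≠ .ket ∧ c ≠ .comma := by
  obtain ⟨i, rfl⟩ := List.mem_ofFn.1 hl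
  exact mem_encodeConst hc

theorem mem_encodeBody {p : Fact S} {c : Γ'} (hc : c ∈ encodeBody p) : c ≠ .bra ∧ c ≠ .ket := by
  simp only [encodeBody, List.mem_append, List.mem_map, List.mem_flatten] at hc
  rcases hc with ⟨b, -, rfl⟩ | ⟨_, ⟨l, hl, rfl⟩, hc⟩
  · simp
  · rcases List.mem_cons.1 hc with rfl | hc
    · simp
    · exact ⟨(mem_segments hl hc).1, (mem_segments hl hc).2.1⟩

/-- The pairs of an input as a string. -/
def encodePairs (L : List (Fact S × Fact S)) : List Γ' :=
  L.flatMap fun pq => encodeFact pq.1 ++ encodeFact pq.2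

theorem encodeInput_eq (x : Input S) :
    encodeInput x = x.facts.flatMap encodeFact ++ Γ'.comma :: encodePairs x.pairs := rfl

/-- The transitions of the automaton that tells the parts of an input apart. Its state says whether
the current letter is between brackets, whether there was a comma outside brackets, and whether the
number of closing brackets is odd. -/
def regionStep : Bool × Bool × Bool → Γ' → Bool × Bool × Bool
  | (_, s, p), .bra => (true, s, p)
  | (_, s, p), .ket => (false, s, !p)
  | (true, s, p), .comma => (true, s, p)
  | (false, _, p), .comma => (false, true, p)
  | q, _ => q

/-- The final state of the automaton `regionStep` on a suffix `l` of an input. It tells the part of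
the input in which `l` starts: there is a comma outside the brackets of `l` iff `l` starts before
the relation, and the parity of the number of facts in `l` tells the two components of a pair
apart. -/
def region (l : List Γ') : Bool × Bool × Bool := l.foldl regionStep (false, false, false)

theorem foldl_regionStep_body {l : List Γ'} (hl : ∀ c ∈ l, c ≠ Γ'.bra ∧ c ≠ .ket) (s p : Bool) :
    l.foldl regionStep (true, s, p) = (true, s, p) := by
  induction l with
  | nil => rfl
  | cons c l ih =>
    have hc := hl c (by simp)
    rw [List.foldl_cons, show regionStep (true, s, p) c = (true, s, p) by
      cases c <;> simp_all [regionStep]]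
    exact ih fun c hc => hl c (by simp [hc])

theorem foldl_regionStep_fact (p : Fact S) (i s b : Bool) :
    (encodeFact p).foldl regionStep (i, s, b) = (false, s, !b) := by
  rw [encodeFact_eq, List.foldl_cons, List.foldl_append,
    show regionStep (i, s, b) .bra = (true, s, b) by cases i <;> rfl,
    foldl_regionStep_body fun c hc => mem_encodeBody hc]
  rfl

theorem foldl_regionStep_facts (L : List (Fact S)) (s b : Bool) :
    ∃ b', (L.flatMap encodeFact).foldl regionStep (false, s, b) = (false, s, b') := by
  induction L generalizing b with
  | nil => exact ⟨b, rfl⟩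
  | cons p L ih =>
    rw [List.flatMap_cons, List.foldl_append, foldl_regionStep_fact]
    exact ih _

theorem foldl_regionStep_pairs (L : List (Fact S × Fact S)) (s b : Bool) :
    (encodePairs L).foldl regionStep (false, s, b) = (false, s, b) := by
  induction L generalizing b with
  | nil => rfl
  | cons p L ih =>
    rw [encodePairs, List.flatMap_cons, List.foldl_append, List.foldl_append,
      foldl_regionStep_fact, foldl_regionStep_fact, Bool.not_not]
    exact ih b

/-- The suffix `l` of an input starts with a fact of the instance. -/
def FactStart (l : List Γ') : Prop := [Γ'.bra] <+: l ∧ (region l).2.1 = true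

/-- The suffix `l` of an input starts with a pair of the relation. -/
def PairStart (l : List Γ') : Prop := [Γ'.bra] <+: l ∧ (region l).2 = (false, false)

theorem bra_prefix_encodeFact (p : Fact S) (l : List Γ') : [Γ'.bra] <+: encodeFact p ++ l := by
  rw [encodeFact_eq]
  exact ⟨_, rfl⟩

theorem factStart_facts (p : Fact S) (L : List (Fact S)) (M : List (Fact S × Fact S)) :
    FactStart ((p :: L).flatMap encodeFact ++ Γ'.comma :: encodePairs M) := by
  refine ⟨?_, ?_⟩
  · rw [List.flatMap_cons, List.append_assoc]
    exact bra_prefix_encodeFact _ _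
  · obtain ⟨b, hb⟩ := foldl_regionStep_facts (p :: L) false false
    rw [region, List.foldl_append, hb, List.foldl_cons,
      show regionStep (false, false, b) .comma = (false, true, b) from rfl, foldl_regionStep_pairs]

theorem region_pairs (L : List (Fact S × Fact S)) :
    region (encodePairs L) = (false, false, false) :=
  foldl_regionStep_pairs L false false

theorem region_fact_pairs (p : Fact S) (L : List (Fact S × Fact S)) :
    region (encodeFact p ++ encodePairs L) = (false, false, true) := by
  rw [region, List.foldl_append, foldl_regionStep_fact, foldl_regionStep_pairs]
  rfl

theorem suffix_append_cases {α : Type} {s a b : List α} (h : s <:+ a ++ b) :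
    s <:+ b ∨ ∃ a', a' <:+ a ∧ s = a' ++ b := by
  obtain ⟨t, ht⟩ := h
  rcases List.append_eq_append_iff.1 ht with ⟨c, rfl, rfl⟩ | ⟨c, rfl, rfl⟩
  · exact .inr ⟨c, ⟨t, rfl⟩, rfl⟩
  · exact .inl ⟨c, rfl⟩

theorem suffix_encodeFact {p : Fact S} {s l : List Γ'} (h : s <:+ encodeFact p ++ l)
    (hs : [Γ'.bra] <+: s) : s = encodeFact p ++ l ∨ s <:+ l := by
  rcases suffix_append_cases h with h | ⟨a, ha, rfl⟩
  · exact .inr h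
  · rw [encodeFact_eq, List.suffix_cons_iff, ← encodeFact_eq] at ha
    rcases ha with rfl | ha
    · exact .inl rfl
    · rcases a with _ | ⟨c, a⟩
      · exact .inr (by simp)
      · obtain rfl : Γ'.bra = c := by simpa using hs
        rcases List.mem_append.1 (ha.subset List.mem_cons_self) with h | h
        · exact absurd rfl (mem_encodeBody h).1
        · simp at h

theorem suffix_encodeFacts {L : List (Fact S)} {s l : List Γ'}
    (h : s <:+ L.flatMap encodeFact ++ l) (hs : [Γ'.bra] <+: s) :
    (∃ p ∈ L, ∃ M : List (Fact S), s = (p :: M).flatMap encodeFact ++ l) ∨ s <:+ l := by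
  induction L with
  | nil => exact .inr h
  | cons p L ih =>
    rw [List.flatMap_cons, List.append_assoc] at h
    rcases suffix_encodeFact h hs with rfl | h
    · exact .inl ⟨p, by simp, L, by simp⟩
    · exact (ih h).imp_left fun ⟨q, hq, h⟩ => ⟨q, List.mem_cons_of_mem _ hq, h⟩

theorem suffix_encodePairs {L : List (Fact S × Fact S)} {s : List Γ'} (h : s <:+ encodePairs L)
    (hs : [Γ'.bra] <+: s) : ∃ pq ∈ L, ∃ M, s = encodePairs (pq :: M) ∨
      s = encodeFact pq.2 ++ encodePairs M := by
  induction L with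
  | nil => rw [List.suffix_nil.1 h] at hs; simp at hs
  | cons pq L ih =>
    rw [encodePairs, List.flatMap_cons, List.append_assoc] at h
    rcases suffix_encodeFact h hs with rfl | h
    · exact ⟨pq, by simp, L, .inl (by simp [encodePairs])⟩
    · rcases suffix_encodeFact h hs with rfl | h
      · exact ⟨pq, by simp, L, .inr (by simp [encodePairs])⟩
      · obtain ⟨pq', h', M, hM⟩ := ih h
        exact ⟨pq', List.mem_cons_of_mem _ h', M, hM⟩

theorem FactStart.exists_mem {x : Input S} {s : List Γ'} (h : s <:+ encodeInput x)
    (hs : FactStart s) : ∃ p ∈ x.facts, encodeFact p <+: s := by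
  rcases suffix_encodeFacts h hs.1 with ⟨p, hp, M, rfl⟩ | h
  · exact ⟨p, hp, by rw [List.flatMap_cons, List.append_assoc]; exact ⟨_, rfl⟩⟩
  · rcases List.suffix_cons_iff.1 h with rfl | h
    · simpa using hs.1
    · obtain ⟨pq, -, M, rfl | rfl⟩ := suffix_encodePairs h hs.1
      · have := hs.2
        simp [region_pairs] at this
      · have := hs.2
        simp [region_fact_pairs] at this

theorem exists_factStart {x : Input S} {p : Fact S} (hp : p ∈ x.facts) :
    ∃ s, s <:+ encodeInput x ∧ FactStart s ∧ encodeFact p <+: s := by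
  obtain ⟨L, M, hL⟩ := List.append_of_mem hp
  refine ⟨_, ?_, factStart_facts p M x.pairs, by
    rw [List.flatMap_cons, List.append_assoc]; exact ⟨_, rfl⟩⟩
  rw [encodeInput_eq, hL, List.flatMap_append, List.append_assoc]
  exact List.suffix_append _ _

theorem PairStart.exists_mem {x : Input S} {s : List Γ'} (h : s <:+ encodeInput x)
    (hs : PairStart s) : ∃ pq ∈ x.pairs, encodeFact pq.1 ++ encodeFact pq.2 <+: s := by
  rw [encodeInput_eq] at h
  rcases suffix_encodeFacts h hs.1 with ⟨p, -, M, rfl⟩ | h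
  · have := hs.2
    rw [Prod.ext_iff, (factStart_facts p M x.pairs).2] at this
    simp at this
  · rcases List.suffix_cons_iff.1 h with rfl | h
    · simpa using hs.1
    · obtain ⟨pq, hpq, M, rfl | rfl⟩ := suffix_encodePairs h hs.1
      · exact ⟨pq, hpq, by rw [encodePairs, List.flatMap_cons]; exact ⟨_, rfl⟩⟩
      · have := hs.2
        simp [region_fact_pairs] at this

theorem exists_pairStart {x : Input S} {pq : Fact S × Fact S} (hp : pq ∈ x.pairs) :
    ∃ s, s <:+ encodeInput x ∧ PairStart s ∧ encodeFact pq.1 ++ encodeFact pq.2 <+: s := by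
  obtain ⟨L, M, hL⟩ := List.append_of_mem hp
  refine ⟨encodePairs (pq :: M), ?_, ⟨?_, by simp [region_pairs]⟩, ?_⟩
  · rw [encodeInput_eq, hL, encodePairs, encodePairs, List.flatMap_append]
    exact (List.suffix_append _ _).trans ((List.suffix_cons _ _).trans (List.suffix_append _ _))
  · rw [encodePairs, List.flatMap_cons, List.append_assoc]
    exact bra_prefix_encodeFact _ _
  · rw [encodePairs, List.flatMap_cons]
    exact ⟨_, rfl⟩

end Encoding

/-! ### Comparing encoded facts -/

theorem append_inj_of_delim {D : Γ' → Bool} {A B X Y : List Γ'} {c d : Γ'}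
    (hA : ∀ a ∈ A, D a = false) (hB : ∀ a ∈ B, D a = false) (hc : D c = true) (hd : D d = true)
    (h : A ++ c :: X = B ++ d :: Y) : A = B := by
  have h₁ := (agree_append_iff (X := X) (Y := X) hA hA hc hc).2 rfl
  nth_rewrite 2 [h] at h₁
  exact (agree_append_iff hA hB hc hd).1 h₁

section Facts

variable {S : Schema}

/-- Tests for the letter that ends a fact. -/
def isKet (c : Γ') : Bool := decide (c = .ket)

/-- Tests for the letters that end a constant. -/
def isSep (c : Γ') : Bool := decide (c = .ket) || decide (c = .comma)

/-- The marked word starts with the fact `p`. -/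
def StartsWith (p : Fact S) (s : List Cell) : Prop := encodeFact p <+: letters s

/-- The marked word starts with the pair of `p` and `q`. -/
def StartsWithPair (p q : Fact S) (s : List Cell) : Prop :=
  encodeFact p ++ encodeFact q <+: letters s

theorem StartsWithPair.left {p q : Fact S} {s : List Cell} (h : StartsWithPair p q s) :
    StartsWith p s :=
  (List.prefix_append _ _).trans h

theorem encodeFact_injective : Function.Injective (encodeFact (S := S)) := fun p q h =>
  (encodeFact_prefix (p := p) (q := q) (X := []) (Y := []) (by simpa using h)).1

theorem ket_notMem_bra_encodeBody (p : Fact S) : Γ'.ket ∉ Γ'.bra :: encodeBody p := by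
  intro h
  rcases List.mem_cons.1 h with h | h
  · cases h
  · exact (mem_encodeBody h).2 rfl

theorem agree_encodeFact (p q : Fact S) (X Y : List Γ') :
    agree isKet (encodeFact p ++ X) (encodeFact q ++ Y) = true ↔ p = q := by
  have h (p : Fact S) (X : List Γ') :
      encodeFact p ++ X = (Γ'.bra :: encodeBody p) ++ Γ'.ket :: X := by
    simp [encodeFact_eq]
  have h' (p : Fact S) : ∀ a ∈ Γ'.bra :: encodeBody p, isKet a = false := by
    intro a ha
    refine decide_eq_false ?_
    rintro rfl
    exact ket_notMem_bra_encodeBody p ha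
  rw [h, h, agree_append_iff (h' p) (h' q) rfl rfl]
  refine ⟨fun e => encodeFact_injective ?_, fun e => by rw [e]⟩
  rw [encodeFact_eq, encodeFact_eq, ← List.cons_append, e, List.cons_append]

/-- The two words start with the same fact. -/
def EqFact (s t : List Cell) : Prop :=
  agree isKet (letters s) (letters t) = true

theorem eqFact_iff {p q : Fact S} {s t : List Cell} (hs : StartsWith p s) (ht : StartsWith q t) :
    EqFact s t ↔ p = q := by
  obtain ⟨X, hX⟩ := hs
  obtain ⟨Y, hY⟩ := ht
  rw [EqFact, ← hX, ← hY]
  exact agree_encodeFact p q X Y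

/-- The first word starts with the second fact of the second word. -/
def EqSecond (s t : List Cell) : Prop :=
  agree isKet (letters s) (skip .ket 1 (letters t)) = true

theorem eqSecond_iff {p q q' : Fact S} {s t : List Cell} (hs : StartsWith p s)
    (ht : StartsWithPair q q' t) :
    EqSecond s t ↔ p = q' := by
  obtain ⟨X, hX⟩ := hs
  obtain ⟨Y, hY⟩ := ht
  have : skip .ket 1 (letters t) = encodeFact q' ++ Y := by
    rw [← hY, encodeFact_eq q, ← List.cons_append, List.append_assoc, List.append_assoc]
    exact skip_append (ket_notMem_bra_encodeBody q) 0 _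
  rw [EqSecond, ← hX, this]
  exact agree_encodeFact p q' X Y

theorem isSep_bits (n : ℕ) : ∀ a ∈ (encodeNat n).map Γ'.bit, isSep a = false := by
  intro a ha
  obtain ⟨b, -, rfl⟩ := List.mem_map.1 ha
  rfl

theorem isSep_segments {p : Fact S} {l : List Γ'} (hl : l ∈ segments p) :
    ∀ a ∈ l, isSep a = false := by
  intro a ha
  have := mem_segments hl ha
  simp [isSep, this.2.1, this.2.2]

theorem sep_cases (L : List (List Γ')) (X : List Γ') : ∃ c Y, isSep c = true ∧
    (L.map (Γ'.comma :: ·)).flatten ++ Γ'.ket :: X = c :: Y := by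
  rcases L with _ | ⟨l, L⟩
  · exact ⟨_, _, rfl, rfl⟩
  · exact ⟨_, _, rfl, rfl⟩

theorem skip_segments (L : List (List Γ')) (hL : ∀ l ∈ L, Γ'.comma ∉ l) (A : List Γ')
    (hA : Γ'.comma ∉ A) (X : List Γ') (i : ℕ) (hi : i < L.length) : ∃ c Y, isSep c = true ∧
      skip .comma (i + 1) (A ++ ((L.map (Γ'.comma :: ·)).flatten ++ Γ'.ket :: X)) =
        L[i] ++ c :: Y := by
  induction L generalizing A i with
  | nil => simp at hi
  | cons l L ih =>
    have : A ++ (((l :: L).map (Γ'.comma :: ·)).flatten ++ Γ'.ket :: X) =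
        A ++ Γ'.comma :: (l ++ ((L.map (Γ'.comma :: ·)).flatten ++ Γ'.ket :: X)) := by simp
    rw [this, skip_append hA]
    cases i with
    | zero =>
      obtain ⟨c, Y, hc, h⟩ := sep_cases L X
      exact ⟨c, Y, hc, by rw [h]; simp [skip]⟩
    | succ i =>
      exact ih (fun l hl => hL l (by simp [hl])) l (hL l (by simp)) i (by simpa using hi)

theorem skip_comma_letters {p : Fact S} {s : List Cell} (hs : StartsWith p s) {i : ℕ}
    (hi : i < (segments p).length) : ∃ c Y, isSep c = true ∧
      skip .comma (i + 1) (letters s) = (segments p)[i] ++ c :: Y := by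
  obtain ⟨X, hX⟩ := hs
  have := skip_segments (segments p) (fun l hl h => (mem_segments hl h).2.2 rfl)
    (Γ'.bra :: (encodeNat p.1.val).map Γ'.bit) (by simp) X i hi
  rw [← hX]
  convert this using 7
  simp [encodeFact_eq, encodeBody]

/-- The facts at the start of the two words have the same constant at position `i`. -/
def EqConst (i : ℕ) (s t : List Cell) : Prop :=
  agree isSep (skip .comma (i + 1) (letters s)) (skip .comma (i + 1) (letters t)) = true

theorem eqConst_iff {p q : Fact S} {s t : List Cell} (hs : StartsWith p s)
    (ht : StartsWith q t) {i : ℕ} (hp : i < (segments p).length) (hq : i < (segments q).length) :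
    EqConst i s t ↔ (segments p)[i]? = (segments q)[i]? := by
  obtain ⟨c, X, hc, hX⟩ := skip_comma_letters hs hp
  obtain ⟨d, Y, hd, hY⟩ := skip_comma_letters ht hq
  rw [EqConst, hX, hY, agree_append_iff (isSep_segments (List.getElem_mem _))
    (isSep_segments (List.getElem_mem _)) hc hd, List.getElem?_eq_getElem hp,
    List.getElem?_eq_getElem hq, Option.some_inj]

/-- The word starts with a fact of the relation number `R`. A closing bracket follows the number if
the relation has no attributes. -/
def HasRel (R : ℕ) (s : List Cell) : Prop :=
  ∃ c, isSep c = true ∧ Γ'.bra :: ((encodeNat R).map Γ'.bit ++ [c]) <+: letters s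

theorem hasRel_iff_comma_or_ket {R : ℕ} {s : List Cell} : HasRel R s ↔
    Γ'.bra :: ((encodeNat R).map Γ'.bit ++ [Γ'.comma]) <+: letters s ∨
      Γ'.bra :: ((encodeNat R).map Γ'.bit ++ [Γ'.ket]) <+: letters s := by
  constructor
  · rintro ⟨c, hc, h⟩
    obtain rfl | rfl : c = .comma ∨ c = .ket := by simpa [isSep, or_comm] using hc
    exacts [.inl h, .inr h]
  · exact fun h => h.elim (fun h => ⟨_, rfl, h⟩) fun h => ⟨_, rfl, h⟩

theorem hasRel_iff {p : Fact S} {s : List Cell} (hs : StartsWith p s) (R : Fin S.numRel) :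
    HasRel R s ↔ p.1 = R := by
  obtain ⟨X, hX⟩ := hs
  obtain ⟨c, Y, hc, hY⟩ := sep_cases (segments p) X
  have hs : letters s = Γ'.bra :: ((encodeNat p.1.val).map Γ'.bit ++ c :: Y) := by
    rw [← hX, ← hY]
    simp [encodeFact_eq, encodeBody]
  constructor
  · rintro ⟨d, hd, Z, hZ⟩
    have : (encodeNat R).map Γ'.bit ++ d :: Z = (encodeNat p.1.val).map Γ'.bit ++ c :: Y := by
      simpa [hs] using hZ
    exact (Fin.ext (encodeNat_inj (bit_map_inj
      (append_inj_of_delim (isSep_bits _) (isSep_bits _) hd hc this)))).symm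
  · rintro rfl
    exact ⟨c, hc, Y, by simp [hs]⟩

end Facts

/-! ### First-order properties of inputs -/

theorem letters_suffix {s w : List Cell} (h : s <:+ w) : letters s <:+ letters w := h.map _

theorem exists_suffix_of_letters {w : List Cell} {l : List Γ'} (h : l <:+ letters w) :
    ∃ s, s <:+ w ∧ letters s = l := by
  rw [List.suffix_iff_eq_drop] at h
  exact ⟨_, List.drop_suffix ((letters w).length - l.length) w,
    by rw [letters, List.map_drop]; exact h.symm⟩

section Loops

variable {S : Schema} {x : Input S} {w : List Cell} (hw : letters w = encodeInput x)
  {R : List Cell → Prop}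
include hw

theorem exists_factStart_iff {P : Fact S → Prop}
    (hR : ∀ s f, StartsWith f s → (R s ↔ P f)) :
    (∃ s, s <:+ w ∧ FactStart (letters s) ∧ R s) ↔ ∃ f ∈ x.inst, P f := by
  constructor
  · rintro ⟨s, hs, hs', h⟩
    obtain ⟨f, hf, hfs⟩ := hs'.exists_mem (hw ▸ letters_suffix hs)
    exact ⟨f, List.mem_toFinset.2 hf, (hR s f hfs).1 h⟩
  · rintro ⟨f, hf, h⟩
    obtain ⟨l, hl, hl', hfl⟩ := exists_factStart (List.mem_toFinset.1 hf)
    obtain ⟨s, hs, rfl⟩ := exists_suffix_of_letters (hw ▸ hl)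
    exact ⟨s, hs, hl', (hR s f hfl).2 h⟩

theorem exists_pairStart_iff {P : Fact S × Fact S → Prop}
    (hR : ∀ s pq, s <:+ w → PairStart (letters s) → StartsWithPair pq.1 pq.2 s → (R s ↔ P pq)) :
    (∃ s, s <:+ w ∧ PairStart (letters s) ∧ R s) ↔ ∃ pq ∈ x.pairs, P pq := by
  constructor
  · rintro ⟨s, hs, hs', h⟩
    obtain ⟨pq, hpq, hp⟩ := hs'.exists_mem (hw ▸ letters_suffix hs)
    exact ⟨pq, hpq, (hR s pq hs hs' hp).1 h⟩
  · rintro ⟨pq, hpq, h⟩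
    obtain ⟨l, hl, hl', hp⟩ := exists_pairStart hpq
    obtain ⟨s, hs, rfl⟩ := exists_suffix_of_letters (hw ▸ hl)
    exact ⟨s, hs, hl', (hR s pq hs hl' hp).2 h⟩

theorem forall_pairStart_iff {P : Fact S × Fact S → Prop}
    (hR : ∀ s pq, s <:+ w → PairStart (letters s) → StartsWithPair pq.1 pq.2 s → (R s ↔ P pq)) :
    (∀ s, s <:+ w → PairStart (letters s) → R s) ↔ ∀ pq ∈ x.pairs, P pq := by
  have := not_congr (exists_pairStart_iff hw (R := fun s => ¬ R s) (P := fun pq => ¬ P pq)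
    fun s pq hs hs' hp => not_congr (hR s pq hs hs' hp))
  simpa only [not_exists, not_and, not_not] using this

end Loops

theorem Dec.factStart (k : ℕ) (i : Var) : Dec k fun V => FactStart (letters (V i)) :=
  (Dec.prefix k _ i).and (Dec.fold k regionStep (false, false, false) (fun q => q.2.1) i)

theorem Dec.pairStart (k : ℕ) (i : Var) : Dec k fun V => PairStart (letters (V i)) :=
  (Dec.prefix k _ i).and <| (Dec.fold k regionStep (false, false, false)
    (fun q => decide (q.2 = (false, false))) i).congr fun _ => decide_eq_true_iff

theorem Dec.hasRel (k R : ℕ) (i : Var) : Dec k fun V => HasRel R (V i) :=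
  ((Dec.prefix k _ i).or (Dec.prefix k _ i)).congr fun _ => hasRel_iff_comma_or_ket.symm

section Definable

variable {S : Schema}

/-- The word assigned to each of the variables `1, …, k - 1` starts with its fact, and variable `0`
holds the input. -/
def Represents (k : ℕ) (x : Input S) (v : Var → Fact S) (V : Var → List Cell) : Prop :=
  letters (V 0) = encodeInput x ∧ ∀ i : Var, 0 < i → i.val < k → StartsWith (v i) (V i)

theorem Represents.update {k : Var} (hk : k ≠ 0) {x : Input S} {v : Var → Fact S}
    {V : Var → List Cell} (hV : Represents k x v V) {f : Fact S} {s : List Cell}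
    (hf : StartsWith f s) :
    Represents (k + 1) x (Function.update v k f) (Function.update V k s) := by
  refine ⟨by simpa only [Function.update_of_ne hk.symm] using hV.1, fun i hi hik => ?_⟩
  by_cases h : i = k
  · subst h
    simpa only [Function.update_self] using hf
  · have : i.val ≠ k.val := fun h' => h (Fin.ext h')
    simpa only [Function.update_of_ne h] using hV.2 i hi (by omega)

/-- A polynomial-time decidable property of an input and of the facts assigned to the variables
`1, …, k - 1`. -/
def Definable (k : ℕ) (P : Input S → (Var → Fact S) → Prop) : Prop :=
  ∃ D, Dec k D ∧ ∀ x v V, Represents k x v V → (D V ↔ P x v)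

namespace Definable

variable {k : ℕ} {P P' : Input S → (Var → Fact S) → Prop}

theorem congr (h : Definable k P) (hP : ∀ x v, P x v ↔ P' x v) : Definable k P' :=
  let ⟨D, hD, h⟩ := h
  ⟨D, hD, fun x v V hV => (h x v V hV).trans (hP x v)⟩

theorem const (k : ℕ) (c : Prop) : Definable (S := S) k fun _ _ => c :=
  ⟨_, .const k c, fun _ _ _ _ => Iff.rfl⟩

theorem not (h : Definable k P) : Definable k fun x v => ¬ P x v :=
  let ⟨_, hD, h⟩ := h
  ⟨_, hD.not, fun x v V hV => not_congr (h x v V hV)⟩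

theorem and (h : Definable k P) (h' : Definable k P') : Definable k fun x v => P x v ∧ P' x v :=
  let ⟨_, hD, h⟩ := h
  let ⟨_, hD', h'⟩ := h'
  ⟨_, hD.and hD', fun x v V hV => and_congr (h x v V hV) (h' x v V hV)⟩

theorem or (h : Definable k P) (h' : Definable k P') : Definable k fun x v => P x v ∨ P' x v :=
  let ⟨_, hD, h⟩ := h
  let ⟨_, hD', h'⟩ := h'
  ⟨_, hD.or hD', fun x v V hV => or_congr (h x v V hV) (h' x v V hV)⟩

theorem imp (h : Definable k P) (h' : Definable k P') : Definable k fun x v => P x v → P' x v :=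
  let ⟨_, hD, h⟩ := h
  let ⟨_, hD', h'⟩ := h'
  ⟨_, hD.imp hD', fun x v V hV => imp_congr (h x v V hV) (h' x v V hV)⟩

theorem iff (h : Definable k P) (h' : Definable k P') : Definable k fun x v => P x v ↔ P' x v :=
  let ⟨_, hD, h⟩ := h
  let ⟨_, hD', h'⟩ := h'
  ⟨_, hD.iff hD', fun x v V hV => iff_congr (h x v V hV) (h' x v V hV)⟩

section Quantifiers

variable {β : Type} {s : Set β} (hs : s.Finite) {Pb : β → Input S → (Var → Fact S) → Prop}
  (h : ∀ b ∈ s, Definable k (Pb b))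
include hs h

theorem exists_mem : Definable k fun x v => ∃ b ∈ s, Pb b x v := by
  choose! D hD h using h
  exact ⟨_, Dec.exists_mem hs hD, fun x v V hV =>
    exists_congr fun b => and_congr_right fun hb => h b hb x v V hV⟩

theorem forall_mem : Definable k fun x v => ∀ b ∈ s, Pb b x v := by
  choose! D hD h using h
  exact ⟨_, Dec.forall_mem hs hD, fun x v V hV => forall₂_congr fun b hb => h b hb x v V hV⟩

end Quantifiers

theorem exists_inst (k : Var) (hk : k ≠ 0) (h : Definable (k + 1) P) :
    Definable k fun x v => ∃ f ∈ x.inst, P x (Function.update v k f) := by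
  obtain ⟨D, hD, h⟩ := h
  refine ⟨_, Dec.exists k hk (P := fun V s => FactStart (letters s) ∧ D (Function.update V k s))
    ((Dec.factStart _ k).and (by simpa using hD)) (by simp), fun x v V hV => ?_⟩
  exact exists_factStart_iff hV.1 fun s f hf => h x _ _ (hV.update hk hf)

theorem forall_inst (k : Var) (hk : k ≠ 0) (h : Definable (k + 1) P) :
    Definable k fun x v => ∀ f ∈ x.inst, P x (Function.update v k f) :=
  (exists_inst k hk h.not).not.congr fun x v => by simp only [not_exists, not_and, not_not]

theorem eqConst (p : Fact S) {i : Var} (hi : 0 < i) (hik : i.val < k) :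
    Definable (S := S) k fun _ v => v i = p := by
  refine ⟨_, Dec.prefix k (encodeFact p) i, fun x v V hV => ?_⟩
  obtain ⟨X, hX⟩ := hV.2 i hi hik
  constructor
  · rintro ⟨Y, hY⟩
    exact (encodeFact_prefix (hX.trans hY.symm)).1
  · rintro rfl
    exact ⟨X, hX⟩

theorem mem_inst_and (q : Fact S) (k : Var) (hk : k ≠ 0) (h : Definable (k + 1) P) :
    Definable k fun x v => q ∈ x.inst ∧ P x (Function.update v k q) :=
  (exists_inst k hk ((eqConst q (Fin.pos_iff_ne_zero.2 hk) (Nat.lt_succ_self _)).and h)).congr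
    fun x v => by
      simp only [Function.update_self]
      constructor
      · rintro ⟨f, hf, rfl, h⟩
        exact ⟨hf, h⟩
      · exact fun ⟨hq, h⟩ => ⟨q, hq, rfl, h⟩

section TwoFacts

variable (i j : Var) (hij : i ≠ j := by decide) (hi : 0 < i := by decide)
  (hj : 0 < j := by decide) (hik : i.val < k := by decide) (hjk : j.val < k := by decide)
include hij hi hj hik hjk

theorem eq : Definable (S := S) k fun _ v => v i = v j :=
  ⟨_, Dec.agree k isKet .ket 0 0 hij, fun _ _ _ hV => eqFact_iff (hV.2 i hi hik) (hV.2 j hj hjk)⟩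

theorem agreeOn (R : Fin S.numRel) (X : Finset (Fin (S.arity R))) :
    Definable k fun _ v => AgreeOn R X (v i) (v j) := by
  refine ⟨_, (Dec.hasRel k R i).and ((Dec.hasRel k R j).and (Dec.forall_mem X.finite_toSet
    (R := fun a V => EqConst a.val (V i) (V j)) fun a _ => Dec.agree k isSep .comma _ _ hij)),
    fun x v V hV => ?_⟩
  have hvi := hV.2 i hi hik
  have hvj := hV.2 j hj hjk
  rw [hasRel_iff hvi, hasRel_iff hvj]
  refine and_congr_right fun hRi => and_congr_right fun hRj => forall₂_congr fun a _ => ?_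
  exact eqConst_iff hvi hvj (by simp [segments, hRi]) (by simp [segments, hRj])

variable {F : Set (FD S)} (hF : F.InjOn FD.rel)
include hF

omit hij hi hj hik hjk in
theorem finite_dependencies : F.Finite :=
  Set.Finite.of_finite_image (Set.toFinite (FD.rel '' F)) hF

theorem clash : Definable k fun _ v => Clash F (v i) (v j) :=
  exists_mem (finite_dependencies hF) fun f _ => ((agreeOn i j hij hi hj hik hjk f.rel f.lhs).and
    (agreeOn i j hij hi hj hik hjk f.rel f.rhs).not).congr fun _ _ => FD.violates_iff.symm

theorem sameGroup : Definable k fun _ v => SameGroup F (v i) (v j) :=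
  (eq i j hij hi hj hik hjk).or (exists_mem (finite_dependencies hF) fun f _ =>
    agreeOn i j hij hi hj hik hjk f.rel f.lhs)

theorem samePart : Definable k fun _ v => SamePart F (v i) (v j) :=
  (eq i j hij hi hj hik hjk).or (exists_mem (finite_dependencies hF) fun f _ =>
    (agreeOn i j hij hi hj hik hjk f.rel f.lhs).and (agreeOn i j hij hi hj hik hjk f.rel f.rhs))

end TwoFacts

theorem prec {k : Var} (i j : Var) (hi : 0 < i := by decide) (hj : 0 < j := by decide)
    (hik : i < k := by decide) (hjk : j < k := by decide) :
    Definable (S := S) k fun x v => x.prec (v i) (v j) := by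
  refine ⟨_, Dec.exists k (hi.trans hik).ne' (P := fun V e => PairStart (letters e) ∧
    EqFact (V i) e ∧ EqSecond (V j) e) ((Dec.pairStart _ k).and
      ((Dec.agree _ isKet .ket 0 0 hik.ne).and (Dec.agree _ isKet .ket 0 1 hjk.ne)))
    (by simp [hik.ne, hjk.ne]), fun x v V ⟨hw, hV⟩ => ?_⟩
  refine (exists_pairStart_iff hw (P := fun pq => v i = pq.1 ∧ v j = pq.2) fun s pq _ _ hp =>
    and_congr (eqFact_iff (hV i hi hik) hp.left) (eqSecond_iff (hV j hj hjk) hp)).trans ?_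
  constructor
  · rintro ⟨⟨p, q⟩, hpq, rfl, rfl⟩
    exact hpq
  · exact fun h => ⟨_, h, rfl, rfl⟩

theorem fst_mem_inst_and_snd_mem_inst :
    Definable (S := S) 1 fun x _ => ∀ pq ∈ x.pairs, pq.1 ∈ x.inst ∧ pq.2 ∈ x.inst := by
  refine ⟨_, Dec.forall 1 (by decide) (P := fun V e => PairStart (letters e) →
    (∃ s, s <:+ V 0 ∧ FactStart (letters s) ∧ EqFact s e) ∧
      ∃ s, s <:+ V 0 ∧ FactStart (letters s) ∧ EqSecond s e) ((Dec.pairStart _ 1).imp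
    ((Dec.exists 2 (by decide) (P := fun V s => FactStart (letters s) ∧ EqFact s (V 1))
      ((Dec.factStart _ 2).and (Dec.agree _ isKet .ket 0 0 (by decide))) (by simp)).and
    (Dec.exists 2 (by decide) (P := fun V s => FactStart (letters s) ∧ EqSecond s (V 1))
      ((Dec.factStart _ 2).and (Dec.agree _ isKet .ket 0 1 (by decide))) (by simp))))
    (by simp), fun x v V ⟨hw, _⟩ => ?_⟩
  refine forall_pairStart_iff hw fun e pq _ _ he => and_congr ?_ ?_
  · simpa only [exists_eq_right] using exists_factStart_iff hw (P := fun f => f = pq.1)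
      fun s f hf => eqFact_iff hf he.left
  · simpa only [exists_eq_right] using exists_factStart_iff hw (P := fun f => f = pq.2)
      fun s f hf => eqSecond_iff hf he

variable {F : Set (FD S)} (hF : F.InjOn FD.rel)
include hF

theorem paretoGood : Definable 2 fun x v => ParetoGood F x.inst x.prec (v 1) :=
  (exists_inst 2 (by decide) <| (clash 2 1 (hF := hF)).and <|
    forall_inst 3 (by decide) <| (samePart 3 1 (hF := hF)).imp <| prec (k := 4) 2 3).not

theorem globalGood : Definable 2 fun x v => GlobalGood F x.inst x.prec (v 1) :=
  (exists_inst 2 (by decide) <| (clash 2 1 (hF := hF)).and <|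
    forall_inst 3 (by decide) <| (samePart 3 1 (hF := hF)).imp <|
      exists_inst 4 (by decide) <| (samePart 4 2 (hF := hF)).and <| prec (k := 5) 4 3).not

theorem commonGood : Definable 2 fun x v => CommonGood F x.inst x.prec (v 1) :=
  exists_inst 2 (by decide) <| (samePart 2 1 (hF := hF)).and <|
    forall_inst 3 (by decide) (prec (k := 4) 3 2).not

theorem conflicting : Definable 1 fun (x : Input S) _ =>
    ∀ p q, x.prec p q → p ∈ x.inst ∧ q ∈ x.inst ∧ Clash F p q :=
  (fst_mem_inst_and_snd_mem_inst.and <| forall_inst 1 (by decide) <| forall_inst 2 (by decide) <|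
    (prec (k := 3) 1 2).imp (clash 1 2 (hF := hF))).congr fun x _ => by
      constructor
      · rintro ⟨hmem, hclash⟩ p q hpq
        obtain ⟨hp, hq⟩ := hmem _ hpq
        exact ⟨hp, hq, hclash p hp q hq hpq⟩
      · exact fun h => ⟨fun pq hpq => ⟨(h _ _ hpq).1, (h _ _ hpq).2.1⟩,
          fun p _ q _ hpq => (h p q hpq).2.2⟩

theorem selects {good : Input S → Fact S → Prop} (hgood : Definable 2 fun x v => good x (v 1))
    (D T : Finset (Fact S)) (q : Fact S) : Definable 1 fun x _ =>
      q ∈ x.inst → ∃ p, Selects F x.inst (good x) D T q p :=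
  (((mem_inst_and q 1 (by decide) (const _ True)).imp <| exists_inst 1 (by decide) <| hgood.and <|
    (mem_inst_and q 2 (by decide) (sameGroup 1 2 (hF := hF))).and <|
    forall_mem D.finite_toSet fun q' _ => (const 2 (SameGroup F q q')).imp <|
      (const 2 (q' ∈ T)).iff (mem_inst_and q' 2 (by decide) (samePart 2 1 (hF := hF))))).congr
  fun x v => by
    rw [and_true]
    refine imp_congr_right fun hq => exists_congr fun p => and_congr_right fun _ =>
      and_congr_right fun _ => and_congr_left fun _ => ?_
    exact and_iff_right hq

theorem answer {good : Input S → Fact S → Prop} (hgood : Definable 2 fun x v => good x (v 1))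
    (Q : Query S) (b : Bool) : Definable 1 fun x _ =>
      ∀ T ∈ Q.facts.powerset, ¬ (Q.Holds T ↔ b = true) →
        ¬ (T ⊆ x.inst ∧ ∀ q ∈ Q.facts, q ∈ x.inst →
          ∃ p, Selects F x.inst (good x) Q.facts T q p) :=
  forall_mem (Finset.finite_toSet _) fun T _ => (const 1 _).imp <| not <|
    (forall_mem T.finite_toSet fun q _ => (mem_inst_and q 1 (by decide) (const _ True)).congr
      fun _ _ => and_iff_left trivial).and <|
    forall_mem Q.facts.finite_toSet fun q _ => selects hF hgood Q.facts T q

end Definable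

theorem Definable.exists_dec {P : Input S → Prop} (h : Definable 1 fun x _ => P x) :
    ∃ D : List Cell → Prop, Dec 1 (fun V => D (V 0)) ∧
      ∀ x w, letters w = encodeInput x → (D w ↔ P x) := by
  rcases isEmpty_or_nonempty (Fact S) with hS | ⟨⟨f⟩⟩
  · refine ⟨fun _ => P ⟨[], []⟩, .const 1 _, fun x w _ => ?_⟩
    obtain ⟨_ | ⟨f, _⟩, _ | ⟨⟨f, _⟩, _⟩⟩ := x
    exacts [Iff.rfl, isEmptyElim f, isEmptyElim f, isEmptyElim f]
  · obtain ⟨D, hD, h⟩ := h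
    refine ⟨fun w => D (Function.update (fun _ => []) 0 w), hD.congr_of_empty fun V hV => ?_,
      fun x w hw => h x (fun _ => f) _ ⟨by simpa using hw, fun i hi hi' => ?_⟩⟩
    · refine iff_of_eq (congrArg D (funext fun i => ?_))
      by_cases hi : i = 0
      · simp [hi]
      · simpa [hi] using hV i (Nat.one_le_iff_ne_zero.2 fun h => hi (Fin.ext h))
    · exact absurd hi' (Nat.not_lt.2 hi)

end Definable

/-! ### Acyclicity on words -/

@[simp] theorem letters_remark (φ : List Cell → List Cell → Prop) (w s : List Cell) :
    letters (remark φ w s) = letters s := by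
  induction s with
  | nil => rfl
  | cons c s ih => simpa [remark, letters] using ih

theorem suffix_remark_iff {φ : List Cell → List Cell → Prop} {w s t : List Cell} :
    t <:+ remark φ w s ↔ ∃ s', s' <:+ s ∧ t = remark φ w s' := by
  induction s with
  | nil => simp [remark]
  | cons c s ih =>
    simp only [remark, List.suffix_cons_iff, ih]
    constructor
    · rintro (rfl | ⟨s', hs', rfl⟩)
      · exact ⟨_, .inl rfl, rfl⟩
      · exact ⟨s', .inr hs', rfl⟩
    · rintro ⟨s', rfl | hs', rfl⟩
      · exact .inl rfl
      · exact .inr ⟨s', hs', rfl⟩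

theorem marked_remark {φ : List Cell → List Cell → Prop} {w s : List Cell} (hs : s ≠ []) :
    Marked (remark φ w s) ↔ φ w s := by
  obtain ⟨c, s, rfl⟩ := List.exists_cons_of_ne_nil hs
  simp [Marked, remark]

theorem not_marked_of_suffix_map_false {u : List Γ'} {t : List Cell}
    (ht : t <:+ u.map fun c => (c, false)) : ¬ Marked t := by
  rintro h
  rcases t with _ | ⟨⟨c, m⟩, t⟩
  · simp [Marked] at h
  · obtain ⟨_, -, hc⟩ := List.mem_map.1 (ht.subset List.mem_cons_self)
    simp_all [Marked]

/-- Every pair of `w` whose second fact is the fact at the start of `s` is marked. -/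
def Unblocked (w s : List Cell) : Prop :=
  ∀ t, t <:+ w → PairStart (letters t) → EqSecond s t → Marked t

theorem Dec.unblocked : Dec 2 fun V => Unblocked (V 0) (V 1) :=
  Dec.forall 2 (by decide) (P := fun V t => PairStart (letters t) → EqSecond (V 1) t → Marked t)
    ((Dec.pairStart _ 2).imp ((Dec.agree _ isKet .ket 0 1 (by decide)).imp (Dec.marked _ 2)))
    (by simp)

/-- All pairs of `w` are marked. -/
def AllMarked (w : List Cell) : Prop := ∀ t, t <:+ w → PairStart (letters t) → Marked t

theorem Dec.allMarked : Dec 1 fun V => AllMarked (V 0) :=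
  Dec.forall 1 (by decide) (P := fun _ t => PairStart (letters t) → Marked t)
    ((Dec.pairStart _ 1).imp (Dec.marked _ 1)) (by simp)

section Acyclic

variable {S : Schema} {x : Input S} {n : ℕ} {w : List Cell}

/-- The word `w` encodes `x`, with marks on the pairs that are settled after `n` rounds. -/
def MarksSettled (x : Input S) (n : ℕ) (w : List Cell) : Prop :=
  letters w = encodeInput x ∧ ∀ t e, t <:+ w → PairStart (letters t) → StartsWithPair e.1 e.2 t →
    (Marked t ↔ Settled x.pairs n e)

theorem marksSettled_zero (x : Input S) :
    MarksSettled x 0 ((encodeInput x).map fun c => (c, false)) :=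
  ⟨by simp [letters, Function.comp_def], fun _ _ ht _ _ =>
    iff_of_false (not_marked_of_suffix_map_false ht) id⟩

theorem MarksSettled.remark (h : MarksSettled x n w) :
    MarksSettled x (n + 1) (remark Unblocked w w) := by
  refine ⟨by rw [letters_remark, h.1], fun t e ht ht' he => ?_⟩
  obtain ⟨s, -, rfl⟩ := suffix_remark_iff.1 ht
  have hs : s ≠ [] := by
    rintro rfl
    simpa [CQA.remark, letters] using ht'.1
  have hse : StartsWithPair e.1 e.2 s := by simpa [StartsWithPair] using he
  rw [marked_remark hs]
  exact forall_pairStart_iff h.1 fun t d ht ht' hd =>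
    imp_congr ((eqSecond_iff hse.left hd).trans eq_comm) (h.2 t d ht ht' hd)

theorem marksSettled_iterate (x : Input S) (n : ℕ) : MarksSettled x n
    ((fun w => remark Unblocked w w)^[n] ((encodeInput x).map fun c => (c, false))) := by
  induction n with
  | zero => exact marksSettled_zero x
  | succ n ih =>
    rw [Function.iterate_succ_apply']
    exact ih.remark

theorem MarksSettled.allMarked_iff (h : MarksSettled x n w) :
    AllMarked w ↔ ∀ e ∈ x.pairs, Settled x.pairs n e :=
  forall_pairStart_iff h.1 h.2

theorem length_pairs_le (x : Input S) : x.pairs.length ≤ (encodeInput x).length := by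
  have one_le : ∀ n ∈ x.pairs.map fun pq => (encodeFact pq.1 ++ encodeFact pq.2).length, 1 ≤ n := by
    intro n hn
    obtain ⟨pq, -, rfl⟩ := List.mem_map.1 hn
    rw [encodeFact_eq, List.cons_append, List.length_cons]
    exact Nat.succ_pos _
  have h := List.length_le_sum_of_one_le _ one_le
  rw [List.length_map, ← List.length_flatMap] at h
  change x.pairs.length ≤ (encodePairs x.pairs).length at h
  rw [encodeInput_eq, List.length_append, List.length_cons]
  omega

end Acyclic

/-! ### The decision problem -/

theorem answerProblem_inPTIME {S : Schema} {F : Set (FD S)} (hF : F.InjOn FD.rel)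
    {X : RepairFamily S} {good : Input S → Fact S → Prop}
    (hgood : Definable 2 fun x v => good x (v 1))
    (hX : ∀ x : Input S, IsPriority F x.inst x.prec → ∀ J, J ∈ X F x.inst x.prec ↔
      IsRepair F x.inst J ∧ ∀ p ∈ J, good x p)
    (hcongr : ∀ x p q, SamePart F p q → good x p → good x q)
    (hex : ∀ x : Input S, IsPriority F x.inst x.prec → ∀ p ∈ x.inst,
      ∃ q ∈ x.inst, SameGroup F q p ∧ good x q) (Q : Query S) (b : Bool) :
    InPTIME encodeInput (answerProblem X F Q b) := by
  obtain ⟨D, hD, hDx⟩ :=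
    ((Definable.conflicting hF).and (Definable.answer hF hgood Q b)).exists_dec
  refine inPTIME_of_dec Dec.unblocked (ψ := fun w => AllMarked w ∧ D w)
    (Dec.allMarked.and hD) fun x => ?_
  have hmarks := marksSettled_iterate x ((encodeInput x).length + 1)
  rw [hmarks.allMarked_iff, hDx x _ hmarks.1,
    ← acyclic_iff_settled _ (Nat.lt_succ_of_le (length_pairs_le x)), ← and_assoc]
  change _ ↔ ((∀ p, ¬ Relation.TransGen x.prec p p) ∧ _) ∧ _
  rw [← isPriority_iff hF]
  exact and_congr_right fun hr => preferredAnswer_iff hF (hX x hr) (hcongr x) (hex x hr) Q b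

end CQA

theorem mainTheorem6 (S : CQA.Schema) (F : Set (CQA.FD S))
    (hF : ∀ f ∈ F, ∀ g ∈ F, f.rel = g.rel → f = g)
    (Q : CQA.Query S) (b : Bool) :
    CQA.InPTIME CQA.encodeInput (CQA.answerProblem (CQA.paretoRep S) F Q b) ∧
    CQA.InPTIME CQA.encodeInput (CQA.answerProblem (CQA.globalRep S) F Q b) ∧
    CQA.InPTIME CQA.encodeInput (CQA.answerProblem (CQA.commonRep S) F Q b) := by
  have hrel : F.InjOn CQA.FD.rel := fun f hf g hg => hF f hf g hg
  have hex (x : CQA.Input S) (hr : CQA.IsPriority F x.inst x.prec) (p) (hp : p ∈ x.inst) :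
      ∃ q ∈ x.inst, CQA.SameGroup F q p ∧ CQA.CommonGood F x.inst x.prec q :=
    let ⟨q, hq, hqp, h⟩ := hr.exists_undominated hrel hp
    ⟨q, hq, hqp, q, hq, .refl q, h⟩
  refine ⟨CQA.answerProblem_inPTIME hrel (.paretoGood hrel)
      (fun x hr J => and_congr_right fun hJ => CQA.paretoOptimal_iff hrel hr hJ)
      (fun x p q => CQA.ParetoGood.congr hrel) (fun x hr p hp => ?_) Q b,
    CQA.answerProblem_inPTIME hrel (.globalGood hrel)
      (fun x hr J => and_congr_right fun hJ => CQA.globallyOptimal_iff hrel hr hJ)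
      (fun x p q => CQA.GlobalGood.congr hrel) (fun x hr p hp => ?_) Q b,
    CQA.answerProblem_inPTIME hrel (.commonGood hrel)
      (fun x hr J => and_congr_right fun hJ => CQA.commonOptimal_iff hrel hr hJ)
      (fun x p q => CQA.CommonGood.congr hrel) hex Q b⟩
  · obtain ⟨q, hq, hqp, hgood⟩ := hex x hr p hp
    exact ⟨q, hq, hqp, hgood.globalGood.paretoGood⟩
  · obtain ⟨q, hq, hqp, hgood⟩ := hex x hr p hp
    exact ⟨q, hq, hqp, hgood.globalGood⟩
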